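/- Let $(M,g)$ be a compact connected smooth Riemannian surface without boundary, with geodesic distance $d$, Riemannian volume $dV_g$ and total volume $|M|=1$, and let $h_1,h_2:M\to\mathbb R$ be smooth positive functions. For $\rho=(\rho_1,\rho_2)$ and $u\in H^1(M)$ put $$J_\rho(u)=\frac12\int_M|\nabla u|^2\,dV_g-\rho_1\Big(\log\int_M h_1e^{u}\,dV_g-\int_M u\,dV_g\Big)-\frac{\rho_2}{2}\Big(\log\int_M h_2e^{-2u}\,dV_g+\int_M 2u\,dV_g\Big).$$ Let $\gamma_1,\gamma_2\subset M$ be two disjoint simple closed curves and let $k,l$ be positive integers. For $A\subset M$ let $A_k=\{\sum_{i=1}^k t_i\delta_{x_i}: t_i\ge 0,\ \sum_{i=1}^k t_i=1,\ x_i\in A\}$ be the $k$-th set of formal barycentres of $A$, and let $(\gamma_1)_k*(\gamma_2)_l$ be the topological join, i.e. the quotient of $(\gamma_1)_k\times(\gamma_2)_l\times[0,1]$ by the equivalence relation generated by $(\sigma_1,\sigma_2,1)\sim(\sigma_1',\sigma_2,1)$ and $(\sigma_1,\sigma_2,0)\sim(\sigma_1,\sigma_2',0)$. For $\lambda>0$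 and $\zeta\in(\gamma_1)_k*(\gamma_2)_l$ represented by $(\sigma_1,\sigma_2,s)$ with $\sigma_1=\sum_{i=1}^k t_i\delta_{x_i}$, $\sigma_2=\sum_{j=1}^l s_j\delta_{y_j}$, define $$\varphi_{\lambda,\zeta}(x)=\log\sum_{i=1}^{k}t_i\Big(\frac{1}{1+\lambda_{1,s}^2\,d(x,x_i)^2}\Big)^2-\frac12\log\sum_{j=1}^{l}s_j\Big(\frac{1}{1+\lambda_{2,s}^2\,d(x,y_j)^2}\Big)^2,\qquad \lambda_{1,s}=(1-s)\lambda,\quad \lambda_{2,s}=s\lambda,$$ which depends only on $\lambda$ and $\zeta$. Suppose $\rho_1\in(8k\pi,8(k+1)\pi)$ and $\rho_2\in(4l\pi,4(l+1)\pi)$. Then $\varphi_{\lambda,\zeta}\in H^1(M)$ for all $\lambda>0$ and all $\zeta$, and $J_\rho(\varphi_{\lambda,\zeta})\to-\infty$ as $\lambda\to+\infty$, uniformly in $\zeta\in(\gamma_1)_k*(\gamma_2)_l$: for every $L$ there is $\Lambda>0$ such that $J_\rho(\varphi_{\lambda,\zeta})\le -L$ for all $\lambda\ge\Lambda$ and all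 $\zeta\in(\gamma_1)_k*(\gamma_2)_l$. -/

import Mathlib

open Set Filter MeasureTheory Manifold Bundle
open scoped ENNReal ContDiff Topology

noncomputable section

namespace TzitzeicaSurface

/-- The Euclidean plane, the model space of a surface. -/
abbrev Plane : Type := EuclideanSpace ℝ (Fin 2)

/-! ### Riemannian volume, weak gradients and the Sobolev space of a surface -/

section Surface

variable {M : Type*} [MetricSpace M] [ChartedSpace Plane M]
  [RiemannianBundle (fun x : M => TangentSpace (𝓡 2) x)]

/-- The tangent vector of `M` at the point with coordinates `y` (in the chart of `M` around `c`)
whose coordinate vector is `v`, that is `d(φ_c⁻¹)_y v`. For `v = e_i` it is the coordinate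
vector field `∂_i`. -/
def coordVector (c : M) (v y : Plane) : TangentSpace (𝓡 2) ((extChartAt (𝓡 2) c).symm y) :=
  mfderiv 𝓘(ℝ, Plane) (𝓡 2) (extChartAt (𝓡 2) c).symm y v

/-- The matrix `g_ij = g(∂_i, ∂_j)` of the metric in the chart around `c`. -/
def gramMatrix (c : M) (y : Plane) : Matrix (Fin 2) (Fin 2) ℝ :=
  Matrix.of fun i j =>
    inner ℝ (coordVector c (EuclideanSpace.single i 1) y)
      (coordVector c (EuclideanSpace.single j 1) y)

/-- `X` is a weak gradient of `u`: in every chart, `u` and the components `g(X, ∂_v)` are locally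
integrable and `g(X, ∂_v)` is the weak derivative of `u` in the direction `v`. -/
def IsWeakGradient (u : M → ℝ) (X : ∀ x : M, TangentSpace (𝓡 2) x) : Prop :=
  ∀ c : M, LocallyIntegrableOn (fun y => u ((extChartAt (𝓡 2) c).symm y))
      (extChartAt (𝓡 2) c).target ∧
    ∀ v : Plane,
      LocallyIntegrableOn (fun y => inner ℝ (X ((extChartAt (𝓡 2) c).symm y)) (coordVector c v y))
        (extChartAt (𝓡 2) c).target ∧
      ∀ ψ : Plane → ℝ, ContDiff ℝ ∞ ψ → HasCompactSupport ψ →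
        tsupport ψ ⊆ (extChartAt (𝓡 2) c).target →
        ∫ y in (extChartAt (𝓡 2) c).target, u ((extChartAt (𝓡 2) c).symm y) * fderiv ℝ ψ y v =
          -∫ y in (extChartAt (𝓡 2) c).target,
            inner ℝ (X ((extChartAt (𝓡 2) c).symm y)) (coordVector c v y) * ψ y

variable [MeasurableSpace M]

/-- The measure `√(det g_ij) dy` of the chart around `c`, carried to `M`. It lives on the domain
of that chart. -/
def chartVolume (c : M) : Measure M :=
  ((((volume : Measure Plane).restrict (extChartAt (𝓡 2) c).target).withDensity
    fun y => ENNReal.ofReal (Real.sqrt (gramMatrix c y).det))).map (extChartAt (𝓡 2) c).symm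

variable (M) in
/-- The Riemannian volume `dV_g`: the measure whose restriction to every chart domain is
`√(det g_ij) dy`. These local measures agree on overlaps, and the volume they glue to is their
least upper bound in the lattice of measures. -/
def riemannianVolume : Measure M := ⨆ c : M, chartVolume c

/-- The Sobolev space `H¹(M)`: functions in `L²` that have a weak gradient in `L²`. -/
def MemH1 (u : M → ℝ) : Prop :=
  MemLp u 2 (riemannianVolume M) ∧
    ∃ X : ∀ x : M, TangentSpace (𝓡 2) x, IsWeakGradient u X ∧
      MemLp (fun x => ‖X x‖) 2 (riemannianVolume M)

open Classical in
/-- The weak gradient `∇u` (unique up to null sets when it exists; `0` if there is none). -/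
def weakGradient (u : M → ℝ) : ∀ x : M, TangentSpace (𝓡 2) x :=
  if h : ∃ X : ∀ x : M, TangentSpace (𝓡 2) x, IsWeakGradient u X then h.choose else 0

/-- The energy functional
`J_ρ(u) = ½∫|∇u|² - ρ₁ (log ∫ h₁ e^u - ∫ u) - (ρ₂/2) (log ∫ h₂ e^{-2u} + ∫ 2u)`. -/
def energy (h₁ h₂ : M → ℝ) (ρ₁ ρ₂ : ℝ) (u : M → ℝ) : ℝ :=
  1 / 2 * ∫ x, ‖weakGradient u x‖ ^ 2 ∂(riemannianVolume M)
    - ρ₁ * (Real.log (∫ x, h₁ x * Real.exp (u x) ∂(riemannianVolume M))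
        - ∫ x, u x ∂(riemannianVolume M))
    - ρ₂ / 2 * (Real.log (∫ x, h₂ x * Real.exp (-2 * u x) ∂(riemannianVolume M))
        + ∫ x, 2 * u x ∂(riemannianVolume M))

end Surface

/-! ### Formal barycentres and the join -/

/-- The formal barycentres `A_k = {∑ i ≤ k, t_i δ_{x_i} : t_i ≥ 0, ∑ t_i = 1, x_i ∈ A}`. -/
def formalBarycentres {M : Type*} [MeasurableSpace M] (A : Set M) (k : ℕ) : Set (Measure M) :=
  {σ | ∃ (t : Fin k → ℝ) (x : Fin k → M), (∀ i, 0 ≤ t i) ∧ ∑ i, t i = 1 ∧ (∀ i, x i ∈ A) ∧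
    σ = ∑ i, ENNReal.ofReal (t i) • Measure.dirac (x i)}

/-- The identifications in the join: at `s = 1` the first component is forgotten, at `s = 0` the
second one. -/
inductive JoinRel (A B : Type*) : A × B × unitInterval → A × B × unitInterval → Prop
  | one (a₁ a₂ : A) (b : B) : JoinRel A B (a₁, b, 1) (a₂, b, 1)
  | zero (a : A) (b₁ b₂ : B) : JoinRel A B (a, b₁, 0) (a, b₂, 0)

/-- The (underlying set of the) topological join `A * B`: the quotient of `A × B × [0,1]` by the
equivalence relation that `JoinRel` generates. -/
def Join (A B : Type*) : Type _ := Quot (JoinRel A B)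

/-! ### Test functions -/

section TestFunctions

variable {M : Type*} [MetricSpace M] [MeasurableSpace M]

/-- `log ∑ t_i (1 / (1 + μ² d(x,x_i)²))²` for `σ = ∑ t_i δ_{x_i}`, written as
an integral against `σ`; see `logBubble_eq`. -/
def logBubble (μ : ℝ) (σ : Measure M) (x : M) : ℝ :=
  Real.log (∫ z, (1 / (1 + μ ^ 2 * dist x z ^ 2)) ^ 2 ∂σ)

theorem logBubble_eq [BorelSpace M] {k : ℕ} (μ : ℝ) (t : Fin k → ℝ) (p : Fin k → M)
    (ht : ∀ i, 0 ≤ t i) (x : M) :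
    logBubble μ (∑ i, ENNReal.ofReal (t i) • Measure.dirac (p i)) x =
      Real.log (∑ i, t i * (1 / (1 + μ ^ 2 * dist x (p i) ^ 2)) ^ 2) := by
  unfold logBubble
  rw [integral_finsetSum_measure]
  · congr 1
    refine Finset.sum_congr rfl fun i _ => ?_
    rw [integral_smul_measure, integral_dirac, ENNReal.toReal_ofReal (ht i), smul_eq_mul]
  · intro i _
    exact (integrable_dirac (by simp)).smul_measure ENNReal.ofReal_ne_top

theorem logBubble_zero {A : Set M} {k : ℕ} (σ : formalBarycentres A k) (x : M) :
    logBubble 0 σ.1 x = 0 := by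
  obtain ⟨σ, t, p, ht, hsum, -, rfl⟩ := σ
  have h : (∑ i, ENNReal.ofReal (t i) • Measure.dirac (p i)) univ = 1 := by
    simp only [Measure.coe_finsetSum, Measure.coe_smul, Finset.sum_apply, Pi.smul_apply,
      measure_univ, smul_eq_mul, mul_one]
    rw [← ENNReal.ofReal_sum_of_nonneg fun i _ => ht i, hsum, ENNReal.ofReal_one]
  simp [logBubble, Measure.real, h]

/-- The test function `φ_{λ,ζ}` for a representative `(σ₁, σ₂, s)` of `ζ`:
`log ∑ t_i (1 + λ₁² d(x,x_i)²)⁻² - ½ log ∑ s_j (1 + λ₂² d(x,y_j)²)⁻²`,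
with `λ₁ = (1 - s) λ` and `λ₂ = s λ`. -/
def testFunctionRep {A B : Set M} {k l : ℕ} (lam : ℝ)
    (ζ : formalBarycentres A k × formalBarycentres B l × unitInterval) (x : M) : ℝ :=
  logBubble ((1 - (ζ.2.2 : ℝ)) * lam) ζ.1.1 x
    - 1 / 2 * logBubble ((ζ.2.2 : ℝ) * lam) ζ.2.1.1 x

/-- The test function `φ_{λ,ζ}` for `ζ ∈ A_k * B_l`. -/
def testFunction {A B : Set M} {k l : ℕ} (lam : ℝ)
    (ζ : Join (formalBarycentres A k) (formalBarycentres B l)) : M → ℝ :=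
  Quot.lift (testFunctionRep lam)
    (by
      rintro _ _ (⟨a₁, a₂, b⟩ | ⟨a, b₁, b₂⟩)
      · funext x
        simp [testFunctionRep, logBubble_zero]
      · funext x
        simp [testFunctionRep, logBubble_zero]) ζ

end TestFunctions

end TzitzeicaSurface

end

namespace TzitzeicaSurface

set_option linter.unusedSectionVars false

/-! ### The metric in coordinates -/

section ChartGeometry

variable {M : Type*} [MetricSpace M] [ChartedSpace Plane M]
  [RiemannianBundle (fun x : M => TangentSpace (𝓡 2) x)]

/-! Write φ = v - w/2, where v has parameter a = (1-s)λ and centres on the first curve, and w has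
parameter b = sλ and centres on the second. Let α = log max(1,a) and β = log max(1,b). Every term of
the energy is compared with α and β, with constants independent of weights, centres and s.

Dirichlet term: the slope of v is at most that of one of its k profiles, so its square is at most 16
∑ a²/(1+a²d²). Each profile has integral at most about 2πα, because small balls have area about πρ²
uniformly (`exists_volume_ball_bounds`, `integral_profile_le`). The curves are a positive distance
apart, so at each point one of the two slopes is bounded and the mixed term is negligible. Half the
Dirichlet integral is thus at most about 16kπ α + 4lπ β.

Means: ∫v = -4α and ∫w = -4β up to small multiples of α and β plus constants
(`exists_abs_integral_bubble_add_le`).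

Exponential terms: integrating over one small ball around a heavy centre gives log ∫ h₁e^φ ≥ -2α +
2β - C and log ∫ h₂e^{-2φ} ≥ 8α - 2β - C (`le_log_integral_exp_bubble`).

In the sum, the ρ₂ terms in α cancel, and so do the ρ₁ terms in β. What remains is at most (16kπ -
2ρ₁)α + (4lπ - ρ₂)β, up to small multiples of α and β and a constant. Both coefficients are
negative, and α + β ≥ log(λ/2) because one of s, 1-s is at least 1/2. This gives divergence
uniformly in the join.

The geometric input is that, in a frame orthonormal at the centre, a chart is nearly an isometry. It
yields the area asymptotics and, with Rademacher's theorem, shows that a Lipschitz function has a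
weak gradient bounded by its local Lipschitz constant. -/

theorem isOpen_target (c : M) : IsOpen (extChartAt (𝓡 2) c).target :=
  isOpen_extChartAt_target c

theorem mfderivWithin_symm_eq (c : M) (y : Plane) :
    mfderivWithin 𝓘(ℝ, Plane) (𝓡 2) (extChartAt (𝓡 2) c).symm (range (𝓡 2)) y =
      mfderiv 𝓘(ℝ, Plane) (𝓡 2) (extChartAt (𝓡 2) c).symm y := by
  rw [(𝓡 2).range_eq_univ, mfderivWithin_univ]

variable [IsManifold (𝓡 2) ∞ M]

theorem mdifferentiableAt_symm {c : M} {y : Plane} (hy : y ∈ (extChartAt (𝓡 2) c).target) :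
    MDifferentiableAt 𝓘(ℝ, Plane) (𝓡 2) (extChartAt (𝓡 2) c).symm y := by
  have := mdifferentiableWithinAt_extChartAt_symm hy
  rwa [(𝓡 2).range_eq_univ, mdifferentiableWithinAt_univ] at this

/-- Every tangent vector at a point of the chart is a coordinate vector, and it is the coordinate
vector of its image under the differential of the chart. -/
theorem coordVector_mfderiv {c : M} {y : Plane} (hy : y ∈ (extChartAt (𝓡 2) c).target)
    (X : TangentSpace (𝓡 2) ((extChartAt (𝓡 2) c).symm y)) :
    coordVector c (mfderiv (𝓡 2) 𝓘(ℝ, Plane) (extChartAt (𝓡 2) c)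
      ((extChartAt (𝓡 2) c).symm y) X) y = X := by
  have := mfderivWithin_extChartAt_symm_comp_mfderiv_extChartAt (I := 𝓡 2) hy
  rw [mfderivWithin_symm_eq] at this
  exact congr($this X)

theorem mfderiv_coordVector {c : M} {y : Plane} (hy : y ∈ (extChartAt (𝓡 2) c).target)
    (v : Plane) :
    mfderiv (𝓡 2) 𝓘(ℝ, Plane) (extChartAt (𝓡 2) c)
      ((extChartAt (𝓡 2) c).symm y) (coordVector c v y) = v := by
  have := mfderiv_extChartAt_comp_mfderivWithin_extChartAt_symm (I := 𝓡 2) hy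
  rw [mfderivWithin_symm_eq] at this
  exact congr($this v)

theorem coordVector_add (c : M) (v w y : Plane) :
    coordVector c (v + w) y = coordVector c v y + coordVector c w y :=
  map_add (mfderiv 𝓘(ℝ, Plane) (𝓡 2) (extChartAt (𝓡 2) c).symm y) v w

theorem coordVector_smul (c : M) (a : ℝ) (v y : Plane) :
    coordVector c (a • v) y = a • coordVector c v y :=
  map_smul (mfderiv 𝓘(ℝ, Plane) (𝓡 2) (extChartAt (𝓡 2) c).symm y) a v

theorem coordVector_eq_zero {c : M} {y : Plane} (hy : y ∈ (extChartAt (𝓡 2) c).target)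
    {v : Plane} (h : coordVector c v y = 0) : v = 0 := by
  have := mfderiv_coordVector hy v
  rw [h, map_zero] at this
  exact this.symm

/-- The metric in the chart around `c`, as a function of the coordinates of the point and of two
coordinate vectors. -/
noncomputable def chartForm (c : M) (y v w : Plane) : ℝ :=
  inner ℝ (coordVector c v y) (coordVector c w y)

theorem chartForm_self (c : M) (y v : Plane) : chartForm c y v v = ‖coordVector c v y‖ ^ 2 :=
  real_inner_self_eq_norm_sq _

theorem chartForm_comm (c : M) (y v w : Plane) : chartForm c y v w = chartForm c y w v :=
  real_inner_comm _ _

theorem chartForm_add_left (c : M) (y v v' w : Plane) :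
    chartForm c y (v + v') w = chartForm c y v w + chartForm c y v' w := by
  simp only [chartForm, coordVector_add, inner_add_left]

theorem chartForm_smul_left (c : M) (y : Plane) (a : ℝ) (v w : Plane) :
    chartForm c y (a • v) w = a * chartForm c y v w := by
  simp only [chartForm, coordVector_smul, real_inner_smul_left]

theorem chartForm_add_right (c : M) (y v w w' : Plane) :
    chartForm c y v (w + w') = chartForm c y v w + chartForm c y v w' := by
  simp only [chartForm, coordVector_add, inner_add_right]

theorem chartForm_smul_right (c : M) (y : Plane) (a : ℝ) (v w : Plane) :
    chartForm c y v (a • w) = a * chartForm c y v w := by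
  simp only [chartForm, coordVector_smul, real_inner_smul_right]

theorem chartForm_pos {c : M} {y : Plane} (hy : y ∈ (extChartAt (𝓡 2) c).target)
    {v : Plane} (hv : v ≠ 0) : 0 < chartForm c y v v := by
  rw [chartForm_self]
  have : coordVector c v y ≠ 0 := fun h => hv (coordVector_eq_zero hy h)
  positivity

theorem gramMatrix_apply (c : M) (y : Plane) (i j : Fin 2) :
    gramMatrix c y i j =
      chartForm c y (EuclideanSpace.single i 1) (EuclideanSpace.single j 1) := rfl

/-- The tangent map of the smooth inverse chart is continuous jointly in point and vector; joint
continuity is what the compactness argument on the unit sphere needs. -/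
theorem continuousOn_coordVector (c : M) :
    ContinuousOn (fun q : Plane × Plane =>
      (⟨(extChartAt (𝓡 2) c).symm q.1, coordVector c q.2 q.1⟩ : TangentBundle (𝓡 2) M))
      ((extChartAt (𝓡 2) c).target ×ˢ univ) := by
  have hs : ContMDiffOn 𝓘(ℝ, Plane) (𝓡 2) ∞ (extChartAt (𝓡 2) c).symm
      (extChartAt (𝓡 2) c).target := contMDiffOn_extChartAt_symm c
  have h1 := hs.continuousOn_tangentMapWithin (by simp) (isOpen_target c).uniqueMDiffOn
  have h2 : Continuous (fun q : Plane × Plane => (⟨q.1, q.2⟩ : TangentBundle 𝓘(ℝ, Plane) Plane)) :=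
    (tangentBundleModelSpaceHomeomorph 𝓘(ℝ, Plane)).symm.continuous
  refine (h1.comp (h2.continuousOn (s := (extChartAt (𝓡 2) c).target ×ˢ univ)) ?_).congr ?_
  · rintro ⟨y, v⟩ ⟨hy, -⟩
    exact hy
  · rintro ⟨y, v⟩ ⟨hy, -⟩
    simp only [tangentMapWithin, Function.comp, coordVector]
    rw [mfderivWithin_of_isOpen (isOpen_target c) hy]

variable [IsContinuousRiemannianBundle Plane (fun x : M => TangentSpace (𝓡 2) x)]

theorem continuousOn_chartForm (c : M) :
    ContinuousOn (fun q : Plane × Plane × Plane => chartForm c q.1 q.2.1 q.2.2)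
      ((extChartAt (𝓡 2) c).target ×ˢ univ) := by
  refine ContinuousOn.inner_bundle (F := Plane)
    (b := fun q : Plane × Plane × Plane => (extChartAt (𝓡 2) c).symm q.1)
    (v := fun q => coordVector c q.2.1 q.1) (w := fun q => coordVector c q.2.2 q.1) ?_ ?_
  · exact (continuousOn_coordVector c).comp (f := fun q : Plane × Plane × Plane => (q.1, q.2.1))
      (by fun_prop) (fun q hq => ⟨hq.1, mem_univ _⟩)
  · exact (continuousOn_coordVector c).comp (f := fun q : Plane × Plane × Plane => (q.1, q.2.2))
      (by fun_prop) (fun q hq => ⟨hq.1, mem_univ _⟩)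

theorem continuousOn_gramMatrix (c : M) :
    ContinuousOn (gramMatrix c) (extChartAt (𝓡 2) c).target := by
  refine continuousOn_pi.2 fun i => continuousOn_pi.2 fun j => ?_
  exact (continuousOn_chartForm c).comp
    (f := fun y => (y, EuclideanSpace.single i (1 : ℝ), EuclideanSpace.single j (1 : ℝ)))
    (by fun_prop) (fun q hq => ⟨hq, mem_univ _⟩)

end ChartGeometry

/-- A positive definite binary quadratic form is the square of a Euclidean norm in suitable linear
coordinates, whose determinant is the root of the discriminant of the form. -/
theorem exists_linear_normSq_eq {a b d : ℝ} (ha : 0 < a) (hD : 0 < a * d - b ^ 2) :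
    ∃ B : Plane →L[ℝ] Plane, B.det = Real.sqrt (a * d - b ^ 2) ∧
      ∀ v, ‖B v‖ ^ 2 = a * v 0 ^ 2 + 2 * b * (v 0 * v 1) + d * v 1 ^ 2 := by
  -- The Cholesky factor obtained by completing the square in the first variable.
  set A : Matrix (Fin 2) (Fin 2) ℝ :=
    !![Real.sqrt a, b / Real.sqrt a; 0, Real.sqrt (a * d - b ^ 2) / Real.sqrt a] with hA
  have hs : 0 < Real.sqrt a := Real.sqrt_pos.2 ha
  have hs2 : Real.sqrt a ^ 2 = a := Real.sq_sqrt ha.le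
  have hD2 : Real.sqrt (a * d - b ^ 2) ^ 2 = a * d - b ^ 2 := Real.sq_sqrt hD.le
  refine ⟨LinearMap.toContinuousLinearMap (Matrix.toLpLin 2 2 A), ?_, fun v => ?_⟩
  · rw [LinearMap.det_toContinuousLinearMap, LinearMap.det_toLpLin, hA, Matrix.det_fin_two_of]
    field_simp
    ring
  · rw [EuclideanSpace.norm_sq_eq]
    simp only [LinearMap.coe_toContinuousLinearMap', Matrix.toLpLin_apply, Fin.sum_univ_two, hA,
      Matrix.mulVec, dotProduct, Matrix.of_apply, Matrix.cons_val', Matrix.cons_val_zero,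
      Matrix.cons_val_one, Real.norm_eq_abs, sq_abs, Matrix.cons_val_fin_one]
    have e1 : (Real.sqrt a * v 0 + b / Real.sqrt a * v 1) ^ 2
        = Real.sqrt a ^ 2 * v 0 ^ 2 + 2 * b * (v 0 * v 1) + b ^ 2 / Real.sqrt a ^ 2 * v 1 ^ 2 := by
      field_simp
      ring
    have e2 : (0 * v 0 + Real.sqrt (a * d - b ^ 2) / Real.sqrt a * v 1) ^ 2
        = Real.sqrt (a * d - b ^ 2) ^ 2 / Real.sqrt a ^ 2 * v 1 ^ 2 := by
      field_simp
      ring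
    rw [e1, e2, hs2, hD2]
    field_simp
    ring

/-! ### Orthonormal frames and lengths of segments in a chart -/

section ChartGeometry

variable {M : Type*} [MetricSpace M] [ChartedSpace Plane M]
  [RiemannianBundle (fun x : M => TangentSpace (𝓡 2) x)]

variable [IsManifold (𝓡 2) ∞ M]

theorem plane_eq_add (v : Plane) :
    v = v 0 • EuclideanSpace.single 0 1 + v 1 • EuclideanSpace.single 1 1 := by
  ext i
  fin_cases i <;> simp

theorem chartForm_eq_gram (c : M) (y v w : Plane) :
    chartForm c y v w = gramMatrix c y 0 0 * (v 0 * w 0) + gramMatrix c y 0 1 * (v 0 * w 1)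
      + gramMatrix c y 1 0 * (v 1 * w 0) + gramMatrix c y 1 1 * (v 1 * w 1) := by
  conv_lhs => rw [plane_eq_add v, plane_eq_add w]
  simp only [chartForm_add_left, chartForm_add_right, chartForm_smul_left, chartForm_smul_right,
    gramMatrix_apply]
  ring

theorem gramMatrix_symm (c : M) (y : Plane) : gramMatrix c y 1 0 = gramMatrix c y 0 1 :=
  chartForm_comm c y _ _

theorem gramMatrix_zero_pos {c : M} {y : Plane} (hy : y ∈ (extChartAt (𝓡 2) c).target) :
    0 < gramMatrix c y 0 0 :=
  chartForm_pos hy (by simp)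

theorem gramMatrix_det_pos {c : M} {y : Plane} (hy : y ∈ (extChartAt (𝓡 2) c).target) :
    0 < (gramMatrix c y).det := by
  have ha := gramMatrix_zero_pos hy
  -- On this vector the form takes the value g₀₀ · det g.
  have h := chartForm_pos hy (v := !₂[-gramMatrix c y 0 1, gramMatrix c y 0 0])
    (fun h => ha.ne' (by simpa using congr($h 1)))
  rw [chartForm_eq_gram, gramMatrix_symm] at h
  simp at h
  rw [Matrix.det_fin_two, gramMatrix_symm]
  refine pos_of_mul_pos_right (a := gramMatrix c y 0 0) ?_ ha.le
  nlinarith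

/-- A linear change of coordinates that makes the metric at the centre of a chart Euclidean. -/
theorem exists_orthonormal_frame {c : M} {y : Plane} (hy : y ∈ (extChartAt (𝓡 2) c).target) :
    ∃ B : Plane ≃L[ℝ] Plane, (B : Plane →L[ℝ] Plane).det = Real.sqrt (gramMatrix c y).det ∧
      ∀ v, ‖B v‖ = ‖coordVector c v y‖ := by
  have hD := gramMatrix_det_pos hy
  have e : (gramMatrix c y).det =
      gramMatrix c y 0 0 * gramMatrix c y 1 1 - gramMatrix c y 0 1 ^ 2 := by
    rw [Matrix.det_fin_two, gramMatrix_symm]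
    ring
  obtain ⟨B, hB, hB'⟩ := exists_linear_normSq_eq (gramMatrix_zero_pos hy) (e ▸ hD)
  have hne : B.det ≠ 0 := by
    rw [hB, ← e]
    exact (Real.sqrt_pos.2 hD).ne'
  refine ⟨B.toContinuousLinearEquivOfDetNeZero hne, ?_, fun v => ?_⟩
  · rw [e, ← hB]
    rfl
  · rw [← sq_eq_sq₀ (norm_nonneg _) (norm_nonneg _), ← chartForm_self, chartForm_eq_gram,
      gramMatrix_symm]
    refine (hB' v).trans ?_
    ring

variable [IsContinuousRiemannianBundle Plane (fun x : M => TangentSpace (𝓡 2) x)]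

/-- Near a point, the metric is comparable to its value at the point, with a factor arbitrarily
close to `1`. -/
theorem eventually_norm_coordVector_comparable {c : M} {y₀ : Plane}
    (hy₀ : y₀ ∈ (extChartAt (𝓡 2) c).target) {B : Plane ≃L[ℝ] Plane}
    (hB : ∀ v, ‖B v‖ = ‖coordVector c v y₀‖) {κ : ℝ} (hκ : 1 < κ) :
    ∀ᶠ y in 𝓝 y₀, ∀ v, ‖coordVector c v y‖ ≤ κ * ‖B v‖ ∧ ‖B v‖ ≤ κ * ‖coordVector c v y‖ := by
  have hT := (isOpen_target c).mem_nhds hy₀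
  -- At `y₀` both inequalities are strict since κ > 1, so they persist near each unit vector.
  -- Compactness makes the neighbourhood uniform, and homogeneity extends the bounds to all vectors.
  have key : ∀ᶠ y in 𝓝 y₀, ∀ v ∈ Metric.sphere (0 : Plane) 1,
      chartForm c y v v < κ ^ 2 * ‖B v‖ ^ 2 ∧ ‖B v‖ ^ 2 < κ ^ 2 * chartForm c y v v := by
    refine (isCompact_sphere (0 : Plane) 1).eventually_forall_of_forall_eventually
      (P := fun y v => chartForm c y v v < κ ^ 2 * ‖B v‖ ^ 2 ∧
        ‖B v‖ ^ 2 < κ ^ 2 * chartForm c y v v) fun v hv => ?_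
    have hcont : ContinuousAt (fun z : Plane × Plane => chartForm c z.1 z.2 z.2) (y₀, v) := by
      refine ((continuousOn_chartForm c).comp (f := fun z : Plane × Plane => (z.1, z.2, z.2))
        (s := (extChartAt (𝓡 2) c).target ×ˢ univ)
        (by fun_prop) (fun q hq => ⟨hq.1, mem_univ _⟩)).continuousAt ?_
      exact prod_mem_nhds hT univ_mem
    have hcB : ContinuousAt (fun z : Plane × Plane => ‖B z.2‖ ^ 2) (y₀, v) := by fun_prop
    have hv0 : v ≠ 0 := fun h => by simp [h] at hv
    have hpos := chartForm_pos hy₀ hv0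
    have heq : chartForm c y₀ v v = ‖B v‖ ^ 2 := by rw [chartForm_self, hB]
    have hκ2 : 1 < κ ^ 2 := by nlinarith
    have hlt : chartForm c y₀ v v < κ ^ 2 * chartForm c y₀ v v := by nlinarith
    refine (hcont.eventually_lt (continuousAt_const.mul hcB) ?_).and
      (hcB.eventually_lt (continuousAt_const.mul hcont) ?_)
    · simpa [← heq] using hlt
    · simpa [← heq] using hlt
  filter_upwards [key] with y hy v
  have hκ0 : 0 < κ := by linarith
  rcases eq_or_ne v 0 with rfl | hv
  · have : coordVector c 0 y = 0 :=
      map_zero (mfderiv 𝓘(ℝ, Plane) (𝓡 2) (extChartAt (𝓡 2) c).symm y)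
    rw [this, norm_zero, map_zero, norm_zero]
    simp
  have hn : 0 < ‖v‖ := norm_pos_iff.2 hv
  obtain ⟨h1, h2⟩ := hy (‖v‖⁻¹ • v) (by simp [norm_smul, hn.ne'])
  rw [chartForm_smul_left, chartForm_smul_right, map_smul, norm_smul, norm_inv, norm_norm,
    chartForm_self] at h1 h2
  have hi : 0 < ‖v‖⁻¹ ^ 2 := by positivity
  constructor
  · refine le_of_sq_le_sq ?_ (by positivity)
    refine le_of_mul_le_mul_left (a := ‖v‖⁻¹ ^ 2) ?_ hi
    nlinarith
  · refine le_of_sq_le_sq ?_ (by positivity)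
    refine le_of_mul_le_mul_left (a := ‖v‖⁻¹ ^ 2) ?_ hi
    nlinarith

theorem norm_coordVector_mfderiv {c p : M} (hp : p ∈ (extChartAt (𝓡 2) c).source)
    (X : TangentSpace (𝓡 2) p) :
    ‖coordVector c (mfderiv (𝓡 2) 𝓘(ℝ, Plane) (extChartAt (𝓡 2) c) p X)
      (extChartAt (𝓡 2) c p)‖ = ‖X‖ := by
  obtain ⟨y, hy, rfl⟩ : ∃ y ∈ (extChartAt (𝓡 2) c).target, (extChartAt (𝓡 2) c).symm y = p :=
    ⟨_, (extChartAt (𝓡 2) c).map_source hp, (extChartAt (𝓡 2) c).left_inv hp⟩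
  -- The two vectors live in tangent spaces whose base points agree only propositionally, so their
  -- norms are compared instead.
  have key : ∀ (w y' : Plane), y' = y → ‖coordVector c w y'‖ = ‖coordVector c w y‖ := by
    rintro w _ rfl
    rfl
  refine (key _ _ ((extChartAt (𝓡 2) c).right_inv hy)).trans ?_
  rw [coordVector_mfderiv hy]

variable [IsRiemannianManifold (𝓡 2) M]

/-- The length of the image of a segment in a chart bounds the distance. -/
theorem exists_dist_symm_le {c : M} {y₀ : Plane} (hT : y₀ ∈ (extChartAt (𝓡 2) c).target)
    {B : Plane ≃L[ℝ] Plane} (hB : ∀ v, ‖B v‖ = ‖coordVector c v y₀‖) {κ : ℝ} (hκ : 1 < κ) :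
    ∃ r > 0, Metric.ball y₀ r ⊆ (extChartAt (𝓡 2) c).target ∧
      ∀ y ∈ Metric.ball y₀ r, ∀ y' ∈ Metric.ball y₀ r,
        dist ((extChartAt (𝓡 2) c).symm y) ((extChartAt (𝓡 2) c).symm y') ≤ κ * ‖B (y' - y)‖ := by
  obtain ⟨r, hr, hsub⟩ := Metric.mem_nhds_iff.1
    (inter_mem ((isOpen_target c).mem_nhds hT) (eventually_norm_coordVector_comparable hT hB hκ))
  refine ⟨r, hr, fun y hy => (hsub hy).1, fun y hy y' hy' => ?_⟩
  set η : ℝ → Plane := fun t => y + t • (y' - y) with hη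
  have hηmem : ∀ t ∈ Icc (0 : ℝ) 1, η t ∈ Metric.ball y₀ r := fun t ht =>
    (convex_ball y₀ r).add_smul_sub_mem hy hy' ht
  have hηd : ∀ t, HasDerivAt η (y' - y) t := fun t => by
    have h := ((hasDerivAt_id t).smul_const (y' - y)).const_add y
    rw [one_smul] at h
    exact h
  have hηs : ContDiff ℝ 1 η := by fun_prop
  have hγs : ContMDiffOn 𝓘(ℝ, ℝ) (𝓡 2) 1 ((extChartAt (𝓡 2) c).symm ∘ η) (Icc 0 1) :=
    (contMDiffOn_extChartAt_symm (n := 1) c).comp hηs.contMDiff.contMDiffOn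
      fun t ht => (hsub (hηmem t ht)).1
  have hlen := riemannianEDist_le_pathELength hγs (x := (extChartAt (𝓡 2) c).symm y)
    (y := (extChartAt (𝓡 2) c).symm y') (by simp [hη]) (by simp [hη]) zero_le_one
  rw [← IsRiemannianManifold.out, pathELength_eq_lintegral_mfderiv_Icc] at hlen
  have hbd : ∫⁻ t in Icc (0 : ℝ) 1,
      ‖mfderiv 𝓘(ℝ, ℝ) (𝓡 2) ((extChartAt (𝓡 2) c).symm ∘ η) t 1‖ₑ
        ≤ ∫⁻ t in Icc (0 : ℝ) 1, ENNReal.ofReal (κ * ‖B (y' - y)‖) := by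
    refine setLIntegral_mono' measurableSet_Icc fun t ht => ?_
    have hm : mfderiv 𝓘(ℝ, ℝ) (𝓡 2) ((extChartAt (𝓡 2) c).symm ∘ η) t 1
        = coordVector c (y' - y) (η t) := by
      have h := mfderiv_comp_apply (I' := 𝓘(ℝ, Plane)) t
        (mdifferentiableAt_symm (hsub (hηmem t ht)).1)
        (hηs.differentiable one_ne_zero t).mdifferentiableAt (1 : ℝ)
      rw [mfderiv_eq_fderiv] at h
      have h' : fderiv ℝ η t 1 = y' - y := by rw [fderiv_apply_one_eq_deriv, (hηd t).deriv]
      exact h.trans (congrArg (mfderiv 𝓘(ℝ, Plane) (𝓡 2) (extChartAt (𝓡 2) c).symm (η t)) h')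
    rw [hm, ← ofReal_norm]
    exact ENNReal.ofReal_le_ofReal ((hsub (hηmem t ht)).2 _).1
  have := hlen.trans hbd
  rw [setLIntegral_const, Real.volume_Icc] at this
  simp only [sub_zero, ENNReal.ofReal_one, mul_one, edist_dist] at this
  exact (ENNReal.ofReal_le_ofReal_iff (by positivity)).1 this

end ChartGeometry

/-! ### Lower bounds for the distance and transition rules -/

section ChartGeometry

variable {M : Type*} [MetricSpace M] [ChartedSpace Plane M]
  [RiemannianBundle (fun x : M => TangentSpace (𝓡 2) x)] [IsManifold (𝓡 2) ∞ M]
  [IsContinuousRiemannianBundle Plane (fun x : M => TangentSpace (𝓡 2) x)]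
  [IsRiemannianManifold (𝓡 2) M]

/-- Charts do not increase lengths much, and short paths stay in the chart. -/
theorem exists_norm_chart_le_dist (c : M) {B : Plane ≃L[ℝ] Plane}
    (hB : ∀ v, ‖B v‖ = ‖coordVector c v (extChartAt (𝓡 2) c c)‖) {κ : ℝ} (hκ : 1 < κ) :
    ∃ r > 0, Metric.ball c r ⊆ (extChartAt (𝓡 2) c).source ∧
      ∀ x ∈ Metric.ball c r, ∀ x' ∈ Metric.ball c r,
        ‖B (extChartAt (𝓡 2) c x' - extChartAt (𝓡 2) c x)‖ ≤ κ * dist x x' := by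
  have hT := mem_extChartAt_target (I := 𝓡 2) c
  have h1 := (continuousAt_extChartAt (I := 𝓡 2) c).eventually
    (eventually_norm_coordVector_comparable hT hB hκ)
  obtain ⟨r, hr, hsub⟩ := Metric.mem_nhds_iff.1
    (inter_mem (extChartAt_source_mem_nhds (I := 𝓡 2) c) h1)
  have hκ0 : 0 < κ := by linarith
  -- A curve starting within r/3 of `c` and shorter than 2r/3 cannot leave the ball of radius r.
  refine ⟨r / 3, by positivity, fun x hx => (hsub (Metric.ball_subset_ball (by linarith) hx)).1,
    fun x hx x' hx' => ?_⟩
  rw [Metric.mem_ball] at hx hx'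
  have hxx' : dist x x' < 2 * (r / 3) := by
    linarith [dist_triangle_right x x' c]
  refine le_of_forall_gt_imp_ge_of_dense fun s hs => ?_
  -- The length allowed to a nearly minimal curve: small enough to stay in the chart, and at most
  -- s/κ so that the final bound is s.
  set ℓ := min (s / κ) (2 * (r / 3)) with hℓ
  have hℓ1 : dist x x' < ℓ := lt_min (by rwa [lt_div_iff₀ hκ0, mul_comm]) hxx'
  have hℓ0 : 0 < ℓ := dist_nonneg.trans_lt hℓ1
  have hed : riemannianEDist (𝓡 2) x x' < ENNReal.ofReal ℓ := by
    rw [← IsRiemannianManifold.out, edist_dist]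
    exact (ENNReal.ofReal_lt_ofReal_iff hℓ0).2 hℓ1
  obtain ⟨γ, hγ0, hγ1, hγs, hγl, -⟩ := exists_lt_locally_constant_of_riemannianEDist_lt hed
    zero_lt_one
  have hmem : ∀ t ∈ Icc (0 : ℝ) 1, γ t ∈ Metric.ball c r := by
    intro t ht
    have h2 : edist x (γ t) < ENNReal.ofReal ℓ := by
      rw [IsRiemannianManifold.out (I := 𝓡 2)]
      calc _ ≤ pathELength (𝓡 2) γ 0 t :=
            riemannianEDist_le_pathELength hγs.contMDiffOn hγ0 rfl ht.1
        _ ≤ pathELength (𝓡 2) γ 0 1 := pathELength_mono le_rfl ht.2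
        _ < _ := hγl
    rw [edist_dist, ENNReal.ofReal_lt_ofReal_iff hℓ0] at h2
    have h3 : ℓ ≤ 2 * (r / 3) := min_le_right _ _
    rw [Metric.mem_ball]
    linarith [dist_triangle (γ t) x c, dist_comm x (γ t)]
  set f : ℝ → Plane := fun t => B (extChartAt (𝓡 2) c (γ t)) with hf
  have hφγ : ContMDiffOn 𝓘(ℝ, ℝ) 𝓘(ℝ, Plane) 1 (extChartAt (𝓡 2) c ∘ γ) (Icc 0 1) :=
    (contMDiffOn_extChartAt (I := 𝓡 2) (n := 1)).comp (t := (chartAt Plane c).source)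
      hγs.contMDiffOn
      (fun t ht => by simpa using (hsub (hmem t ht)).1)
  have hfs : ContDiffOn ℝ 1 f (Icc 0 1) :=
    B.contDiff.comp_contDiffOn (contMDiffOn_iff_contDiffOn.1 hφγ)
  have hint := enorm_sub_le_lintegral_deriv_of_contDiffOn_Icc hfs zero_le_one
  have hbd : ∫⁻ t in Icc (0 : ℝ) 1, ‖deriv f t‖ₑ ≤
      ∫⁻ t in Icc (0 : ℝ) 1, ENNReal.ofReal κ * ‖mfderiv 𝓘(ℝ, ℝ) (𝓡 2) γ t 1‖ₑ := by
    refine setLIntegral_mono' measurableSet_Icc fun t ht => ?_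
    have hs := hsub (hmem t ht)
    have hs1 : γ t ∈ (chartAt Plane c).source := by simpa using hs.1
    have hγd := (hγs.mdifferentiable one_ne_zero) t
    set X := mfderiv 𝓘(ℝ, ℝ) (𝓡 2) γ t 1 with hX
    have hm : fderiv ℝ (extChartAt (𝓡 2) c ∘ γ) t 1 =
        mfderiv (𝓡 2) 𝓘(ℝ, Plane) (extChartAt (𝓡 2) c) (γ t) X := by
      have h := mfderiv_comp_apply (I' := 𝓡 2) t
        (mdifferentiableAt_extChartAt hs1) hγd (1 : ℝ)
      rw [mfderiv_eq_fderiv] at h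
      exact h
    have hd : DifferentiableAt ℝ (extChartAt (𝓡 2) c ∘ γ) t :=
      ((mdifferentiableAt_extChartAt hs1).comp t hγd).differentiableAt
    have hfd : deriv f t = B (fderiv ℝ (extChartAt (𝓡 2) c ∘ γ) t 1) := by
      have h := B.hasFDerivAt.comp_hasDerivAt t hd.hasDerivAt
      rw [← fderiv_apply_one_eq_deriv] at h
      exact h.deriv
    rw [hfd, hm, ← ofReal_norm, ← ofReal_norm, ← ENNReal.ofReal_mul hκ0.le]
    refine ENNReal.ofReal_le_ofReal (((hs.2 _).2).trans ?_)
    rw [norm_coordVector_mfderiv hs.1]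
  rw [lintegral_const_mul' _ _ ENNReal.ofReal_ne_top, ← pathELength_eq_lintegral_mfderiv_Icc]
    at hbd
  have hfin : ‖f 1 - f 0‖ₑ ≤ ENNReal.ofReal (κ * ℓ) := by
    rw [ENNReal.ofReal_mul hκ0.le]
    exact hint.trans (hbd.trans (by gcongr))
  rw [← ofReal_norm, ENNReal.ofReal_le_ofReal_iff (by positivity)] at hfin
  simp only [hf, hγ0, hγ1, ← map_sub] at hfin
  refine hfin.trans ?_
  calc κ * ℓ ≤ κ * (s / κ) := by gcongr; exact min_le_left _ _
    _ = s := by field_simp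

/-- The transition rule for the metric between two charts. -/
theorem chartForm_transition {c c' : M} {y : Plane} (hy : y ∈ (extChartAt (𝓡 2) c).target)
    (hy' : (extChartAt (𝓡 2) c).symm y ∈ (extChartAt (𝓡 2) c').source) (v w : Plane) :
    chartForm c' (extChartAt (𝓡 2) c' ((extChartAt (𝓡 2) c).symm y))
      (fderiv ℝ (extChartAt (𝓡 2) c' ∘ (extChartAt (𝓡 2) c).symm) y v)
      (fderiv ℝ (extChartAt (𝓡 2) c' ∘ (extChartAt (𝓡 2) c).symm) y w) = chartForm c y v w := by
  have hd : ∀ v, fderiv ℝ (extChartAt (𝓡 2) c' ∘ (extChartAt (𝓡 2) c).symm) y v =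
      mfderiv (𝓡 2) 𝓘(ℝ, Plane) (extChartAt (𝓡 2) c') ((extChartAt (𝓡 2) c).symm y)
        (coordVector c v y) := by
    intro v
    have h := mfderiv_comp_apply (I' := 𝓡 2) y
      (mdifferentiableAt_extChartAt (x := c') (by simpa using hy'))
      (mdifferentiableAt_symm hy) v
    rw [mfderiv_eq_fderiv] at h
    exact h
  -- Polarisation: the norms agree, and expanding at v + w recovers the mixed values.
  have key : ∀ u, chartForm c' (extChartAt (𝓡 2) c' ((extChartAt (𝓡 2) c).symm y))
      (fderiv ℝ (extChartAt (𝓡 2) c' ∘ (extChartAt (𝓡 2) c).symm) y u)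
      (fderiv ℝ (extChartAt (𝓡 2) c' ∘ (extChartAt (𝓡 2) c).symm) y u) = chartForm c y u u := by
    intro u
    rw [chartForm_self, chartForm_self, hd, norm_coordVector_mfderiv hy']
  have h1 := key (v + w)
  rw [map_add] at h1
  simp only [chartForm_add_left, chartForm_add_right] at h1
  rw [key v, key w, chartForm_comm c' _ (fderiv ℝ _ y w) (fderiv ℝ _ y v),
    chartForm_comm c _ w v] at h1
  linarith

theorem differentiableAt_transition {c c' : M} {y : Plane}
    (hy : y ∈ (extChartAt (𝓡 2) c).target)
    (hy' : (extChartAt (𝓡 2) c).symm y ∈ (extChartAt (𝓡 2) c').source) :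
    DifferentiableAt ℝ (extChartAt (𝓡 2) c' ∘ (extChartAt (𝓡 2) c).symm) y :=
  ((mdifferentiableAt_extChartAt (I := 𝓡 2) (x := c') (by simpa using hy')).comp y
    (mdifferentiableAt_symm hy)).differentiableAt

/-- The transition rule for the Riemannian area density. -/
theorem sqrt_det_gramMatrix_transition {c c' : M} {y : Plane}
    (hy : y ∈ (extChartAt (𝓡 2) c).target)
    (hy' : (extChartAt (𝓡 2) c).symm y ∈ (extChartAt (𝓡 2) c').source) :
    |(fderiv ℝ (extChartAt (𝓡 2) c' ∘ (extChartAt (𝓡 2) c).symm) y).det| *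
      Real.sqrt (gramMatrix c' (extChartAt (𝓡 2) c' ((extChartAt (𝓡 2) c).symm y))).det =
      Real.sqrt (gramMatrix c y).det := by
  set D := fderiv ℝ (extChartAt (𝓡 2) c' ∘ (extChartAt (𝓡 2) c).symm) y with hD
  set y' := extChartAt (𝓡 2) c' ((extChartAt (𝓡 2) c).symm y) with hyy
  have hdet : D.det = D (EuclideanSpace.single 0 1) 0 * D (EuclideanSpace.single 1 1) 1
      - D (EuclideanSpace.single 1 1) 0 * D (EuclideanSpace.single 0 1) 1 := by
    have := LinearMap.det_toMatrix (EuclideanSpace.basisFun (Fin 2) ℝ).toBasis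
      (D : Plane →ₗ[ℝ] Plane)
    rw [ContinuousLinearMap.det, ← this, Matrix.det_fin_two]
    simp [LinearMap.toMatrix_apply]
  have hg : ∀ i j, gramMatrix c y i j = chartForm c' y' (D (EuclideanSpace.single i 1))
      (D (EuclideanSpace.single j 1)) := fun i j => (chartForm_transition hy hy' _ _).symm
  -- This is G = Dᵀ G' D at the level of determinants.
  have h2 : (gramMatrix c y).det = D.det ^ 2 * (gramMatrix c' y').det := by
    rw [Matrix.det_fin_two, Matrix.det_fin_two, hg, hg, hg, hg, hdet]
    simp only [chartForm_eq_gram, gramMatrix_symm]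
    ring
  rw [h2, Real.sqrt_mul (sq_nonneg _), Real.sqrt_sq_eq_abs]

end ChartGeometry

/-! ### Riemannian volume and the area of small balls -/

section Volume

variable {M : Type*} [MetricSpace M] [ChartedSpace Plane M]
  [RiemannianBundle (fun x : M => TangentSpace (𝓡 2) x)]
  [MeasurableSpace M] [BorelSpace M]

/-- The part of a Borel set in a chart, in coordinates. -/
def chartPreimage (c : M) (S : Set M) : Set Plane :=
  (extChartAt (𝓡 2) c).target ∩ (extChartAt (𝓡 2) c).symm ⁻¹' S

theorem measurableSet_chartPreimage (c : M) {S : Set M} (hS : MeasurableSet S) :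
    MeasurableSet (chartPreimage c S) := by
  -- The inverse chart is controlled only on its target, so measurability is proved on the subtype
  -- and carried along the inclusion.
  have h1 : Measurable ((extChartAt (𝓡 2) c).target.domRestrict
      (extChartAt (𝓡 2) c).symm) :=
    (continuousOn_iff_continuous_domRestrict.1 (continuousOn_extChartAt_symm c)).measurable
  have h2 := (isOpen_target c).measurableSet.subtype_image (h1 hS)
  convert h2 using 1
  ext y
  simp only [chartPreimage, mem_inter_iff, mem_preimage, mem_image, Subtype.exists,
    domRestrict_apply, exists_and_right, exists_eq_right]
  exact ⟨fun h => ⟨h.1, h.2⟩, fun ⟨h1, h2⟩ => ⟨h1, h2⟩⟩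

theorem chartVolume_apply (c : M) {S : Set M} (hS : MeasurableSet S) :
    chartVolume c S =
      ∫⁻ y in chartPreimage c S, ENNReal.ofReal (Real.sqrt (gramMatrix c y).det) := by
  have hm : AEMeasurable (extChartAt (𝓡 2) c).symm
      ((volume : Measure Plane).restrict (extChartAt (𝓡 2) c).target) :=
    (continuousOn_extChartAt_symm c).aemeasurable (isOpen_target c).measurableSet
  rw [chartVolume, Measure.map_apply_of_aemeasurable
    (hm.mono_ac (withDensity_absolutelyContinuous _ _)) hS, withDensity_apply',
    Measure.restrict_restrict' (isOpen_target c).measurableSet, inter_comm]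
  rfl

variable [IsManifold (𝓡 2) ∞ M]
  [IsContinuousRiemannianBundle Plane (fun x : M => TangentSpace (𝓡 2) x)]
  [IsRiemannianManifold (𝓡 2) M]

/-- Change of variables along the transition map, whose Jacobian is exactly the ratio of the two
densities. -/
theorem chartVolume_eq_of_subset {c c' : M} {S : Set M} (hS : MeasurableSet S)
    (hc : S ⊆ (extChartAt (𝓡 2) c).source) (hc' : S ⊆ (extChartAt (𝓡 2) c').source) :
    chartVolume c' S = chartVolume c S := by
  have him : chartPreimage c' S =
      (extChartAt (𝓡 2) c' ∘ (extChartAt (𝓡 2) c).symm) '' chartPreimage c S := by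
    ext z
    constructor
    · rintro ⟨hz, hzS⟩
      refine ⟨extChartAt (𝓡 2) c ((extChartAt (𝓡 2) c').symm z),
        ⟨(extChartAt (𝓡 2) c).map_source (hc hzS), ?_⟩, ?_⟩
      · rw [mem_preimage, (extChartAt (𝓡 2) c).left_inv (hc hzS)]
        exact hzS
      · simp only [Function.comp]
        rw [(extChartAt (𝓡 2) c).left_inv (hc hzS), (extChartAt (𝓡 2) c').right_inv hz]
    · rintro ⟨y, ⟨hy, hyS⟩, rfl⟩
      refine ⟨(extChartAt (𝓡 2) c').map_source (hc' hyS), ?_⟩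
      rw [mem_preimage, Function.comp, (extChartAt (𝓡 2) c').left_inv (hc' hyS)]
      exact hyS
  have hinj : InjOn (extChartAt (𝓡 2) c' ∘ (extChartAt (𝓡 2) c).symm) (chartPreimage c S) := by
    rintro y ⟨hy, hyS⟩ y' ⟨hy', hyS'⟩ h
    exact (extChartAt (𝓡 2) c).symm.injOn hy hy'
      ((extChartAt (𝓡 2) c').injOn (hc' hyS) (hc' hyS') h)
  rw [chartVolume_apply c' hS, chartVolume_apply c hS, him,
    lintegral_image_eq_lintegral_abs_det_fderiv_mul volume (measurableSet_chartPreimage c hS)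
      (f' := fderiv ℝ (extChartAt (𝓡 2) c' ∘ (extChartAt (𝓡 2) c).symm))
      (fun y hy => (differentiableAt_transition hy.1 (hc' hy.2)).hasFDerivAt.hasFDerivWithinAt)
      hinj]
  refine setLIntegral_congr_fun (measurableSet_chartPreimage c hS) fun y hy => ?_
  rw [← ENNReal.ofReal_mul (abs_nonneg _)]
  exact congrArg _ (sqrt_det_gramMatrix_transition hy.1 (hc' hy.2))

theorem chartVolume_compl_source (c : M) :
    chartVolume c (extChartAt (𝓡 2) c).sourceᶜ = 0 := by
  rw [chartVolume_apply c (isOpen_extChartAt_source c).measurableSet.compl]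
  have : chartPreimage c (extChartAt (𝓡 2) c).sourceᶜ = ∅ := by
    ext y
    simp only [chartPreimage, mem_inter_iff, mem_preimage, mem_compl_iff, mem_empty_iff_false,
      iff_false, not_and, not_not]
    exact fun hy => (extChartAt (𝓡 2) c).map_target hy
  rw [this, Measure.restrict_empty, lintegral_zero_measure]

/-- On the domain of a chart, the Riemannian volume is the one computed in that chart. -/
theorem riemannianVolume_eq_chartVolume {c : M} {S : Set M} (hS : MeasurableSet S)
    (hc : S ⊆ (extChartAt (𝓡 2) c).source) : riemannianVolume M S = chartVolume c S := by
  refine le_antisymm ?_ (le_iSup (chartVolume (M := M)) c S)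
  set U := (extChartAt (𝓡 2) c).source with hU
  have hUm : MeasurableSet U := (isOpen_extChartAt_source c).measurableSet
  -- A supremum of measures is not computed setwise. It is bounded by exhibiting one measure that
  -- dominates every chart volume and equals `chartVolume c` on subsets of the domain.
  have hle : riemannianVolume M ≤ chartVolume c + (riemannianVolume M).restrict Uᶜ := by
    refine iSup_le fun c' => Measure.le_iff.2 fun T hT => ?_
    set U' := (extChartAt (𝓡 2) c').source with hU'
    have hUm' : MeasurableSet U' := (isOpen_extChartAt_source c').measurableSet
    rw [← measure_inter_add_sdiff T hUm, Measure.add_apply, Measure.restrict_apply hT]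
    refine add_le_add ?_ (le_iSup (chartVolume (M := M)) c' (T \ U))
    calc chartVolume c' (T ∩ U) ≤ chartVolume c' (T ∩ U ∩ U') + chartVolume c' U'ᶜ := by
          refine (measure_mono fun x hx => ?_).trans (measure_union_le _ _)
          by_cases h : x ∈ U'
          · exact Or.inl ⟨hx, h⟩
          · exact Or.inr h
      _ = chartVolume c (T ∩ U ∩ U') := by
          rw [chartVolume_compl_source, add_zero, chartVolume_eq_of_subset
            ((hT.inter hUm).inter hUm') (fun x hx => hx.1.2) (fun x hx => hx.2)]
      _ ≤ chartVolume c T := measure_mono fun x hx => hx.1.1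
  refine (hle S).trans ?_
  rw [Measure.add_apply, Measure.restrict_apply hS]
  have : S ∩ Uᶜ = ∅ := by
    ext x
    simpa using fun h => hc h
  simp [this]

/-- Near any point, the area of small balls is asymptotic to the Euclidean one, uniformly in the
centre of the ball. -/
theorem exists_volume_ball_bounds_near (c : M) {κ : ℝ} (hκ : 1 < κ) :
    ∃ r > 0, ∀ x ∈ Metric.ball c r, ∀ ρ : ℝ, 0 < ρ → ρ < r →
      riemannianVolume M (Metric.ball x ρ) ≤ ENNReal.ofReal (κ ^ 3 * (Real.pi * ρ ^ 2)) ∧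
      ENNReal.ofReal ((κ ^ 3)⁻¹ * (Real.pi * ρ ^ 2)) ≤ riemannianVolume M (Metric.ball x ρ) := by
  set y₀ := extChartAt (𝓡 2) c c with hy₀
  have hT : y₀ ∈ (extChartAt (𝓡 2) c).target := mem_extChartAt_target c
  have hκ0 : 0 < κ := by linarith
  obtain ⟨B, hBdet, hB⟩ := exists_orthonormal_frame hT
  obtain ⟨r₁, hr₁, hr₁s, hD1⟩ := exists_dist_symm_le hT hB hκ
  obtain ⟨r₂, hr₂, hr₂s, hD2⟩ := exists_norm_chart_le_dist c hB hκ
  set b := Real.sqrt (gramMatrix c y₀).det with hb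
  have hb0 : 0 < b := Real.sqrt_pos.2 (gramMatrix_det_pos hT)
  have hcont : ContinuousAt (fun y => Real.sqrt (gramMatrix c y).det) y₀ :=
    (Continuous.matrix_det continuous_id).continuousAt.comp
      ((continuousOn_gramMatrix c).continuousAt ((isOpen_target c).mem_nhds hT)) |>.sqrt
  have hev : ∀ᶠ y in 𝓝 y₀, Real.sqrt (gramMatrix c y).det < κ * b ∧
      κ⁻¹ * b < Real.sqrt (gramMatrix c y).det :=
    (hcont.eventually_lt continuousAt_const (by nlinarith)).and
      (continuousAt_const.eventually_lt hcont (by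
        have : κ⁻¹ < 1 := inv_lt_one_of_one_lt₀ hκ
        nlinarith))
  obtain ⟨r₃, hr₃, hr₃s⟩ := Metric.mem_nhds_iff.1 hev
  set r₄ := min r₁ r₃ with hr₄
  have hr₄0 : 0 < r₄ := lt_min hr₁ hr₃
  have hφ : ∀ᶠ x in 𝓝 c, extChartAt (𝓡 2) c x ∈ Metric.ball y₀ (r₄ / 2) :=
    (continuousAt_extChartAt (I := 𝓡 2) c).eventually
      (Metric.ball_mem_nhds _ (by positivity))
  obtain ⟨r₅, hr₅, hr₅s⟩ := Metric.mem_nhds_iff.1 hφ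
  -- Controls ‖v‖ by ‖B v‖, so that small balls for the frame norm stay in the region where the
  -- estimates hold.
  set m := ‖(B.symm : Plane →L[ℝ] Plane)‖ + 1 with hm
  have hm0 : 0 < m := by positivity
  have hBs : ∀ v, ‖v‖ ≤ m * ‖B v‖ := fun v => by
    have := (B.symm : Plane →L[ℝ] Plane).le_opNorm (B v)
    simp only [ContinuousLinearEquiv.coe_coe, ContinuousLinearEquiv.symm_apply_apply] at this
    nlinarith [norm_nonneg (B v)]
  refine ⟨min (min (r₂ / 2) (r₅ / 2)) (r₄ / (2 * m)), by positivity, fun x hx ρ hρ hρr => ?_⟩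
  have hρ2 : ρ < r₂ / 2 := hρr.trans_le ((min_le_left _ _).trans (min_le_left _ _))
  have hρ5 : ρ < r₅ / 2 := hρr.trans_le ((min_le_left _ _).trans (min_le_right _ _))
  have hρ4 : ρ < r₄ / (2 * m) := hρr.trans_le (min_le_right _ _)
  rw [Metric.mem_ball] at hx
  have hx2 : dist x c < r₂ / 2 := hx.trans_le ((min_le_left _ _).trans (min_le_left _ _))
  have hx5 : dist x c < r₅ / 2 := hx.trans_le ((min_le_left _ _).trans (min_le_right _ _))
  have hsub2 : Metric.ball x ρ ⊆ Metric.ball c r₂ := Metric.ball_subset_ball' (by linarith)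
  have hsub5 : Metric.ball x ρ ⊆ Metric.ball c r₅ := Metric.ball_subset_ball' (by linarith)
  have hxφ : extChartAt (𝓡 2) c x ∈ Metric.ball y₀ (r₄ / 2) :=
    hr₅s (hsub5 (Metric.mem_ball_self hρ))
  have hxs : x ∈ (extChartAt (𝓡 2) c).source := hr₂s (hsub2 (Metric.mem_ball_self hρ))
  -- The factor 1/b cancels the density, which lies within a factor κ of b.
  have hBm : ∀ s : Set Plane, volume (B ⁻¹' s) = ENNReal.ofReal b⁻¹ * volume s := fun s => by
    have := Measure.addHaar_preimage_continuousLinearMap (volume : Measure Plane)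
      (f := (B : Plane →L[ℝ] Plane)) (by
        change (B : Plane →L[ℝ] Plane).det ≠ 0
        rw [hBdet]; exact hb0.ne') s
    refine this.trans ?_
    change ENNReal.ofReal |(B : Plane →L[ℝ] Plane).det⁻¹| * _ = _
    rw [hBdet, abs_of_pos (inv_pos.2 hb0)]
  rw [riemannianVolume_eq_chartVolume Metric.isOpen_ball.measurableSet (hsub2.trans hr₂s),
    chartVolume_apply c Metric.isOpen_ball.measurableSet]
  set P := chartPreimage c (Metric.ball x ρ) with hP
  have hPm : MeasurableSet P := measurableSet_chartPreimage c Metric.isOpen_ball.measurableSet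
  have hPdens : ∀ y ∈ P, Real.sqrt (gramMatrix c y).det < κ * b ∧
      κ⁻¹ * b < Real.sqrt (gramMatrix c y).det := by
    rintro y ⟨hy, hyS⟩
    have := hr₅s (hsub5 hyS)
    rw [mem_ofPred_eq, (extChartAt (𝓡 2) c).right_inv hy] at this
    exact hr₃s (Metric.ball_subset_ball (by linarith [min_le_right r₁ r₃]) this)
  constructor
  -- Enlarging the radius costs κ² in area and the density one more κ, hence κ³.
  · have hsub : P ⊆ B ⁻¹' Metric.ball (B (extChartAt (𝓡 2) c x)) (κ * ρ) := by
      rintro y ⟨hy, hyS⟩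
      have h1 := hD2 x (hsub2 (Metric.mem_ball_self hρ)) _ (hsub2 hyS)
      rw [(extChartAt (𝓡 2) c).right_inv hy, map_sub] at h1
      rw [mem_preimage, Metric.mem_ball, dist_eq_norm]
      rw [mem_preimage, Metric.mem_ball, dist_comm] at hyS
      exact h1.trans_lt (by gcongr)
    calc ∫⁻ y in P, ENNReal.ofReal (Real.sqrt (gramMatrix c y).det)
        ≤ ∫⁻ y in P, ENNReal.ofReal (κ * b) :=
          setLIntegral_mono' hPm fun y hy => ENNReal.ofReal_le_ofReal (hPdens y hy).1.le
      _ = ENNReal.ofReal (κ * b) * volume P := setLIntegral_const _ _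
      _ ≤ ENNReal.ofReal (κ * b) *
          volume (B ⁻¹' Metric.ball (B (extChartAt (𝓡 2) c x)) (κ * ρ)) := by gcongr
      _ = ENNReal.ofReal (κ ^ 3 * (Real.pi * ρ ^ 2)) := by
          rw [hBm, EuclideanSpace.volume_ball_fin_two, ← ENNReal.ofReal_pow (by positivity),
            ← ENNReal.ofReal_mul (by positivity), ← ENNReal.ofReal_mul (by positivity),
            ← ENNReal.ofReal_mul (by positivity)]
          congr 1
          field_simp
  · have hsub : B ⁻¹' Metric.ball (B (extChartAt (𝓡 2) c x)) (κ⁻¹ * ρ) ⊆ P := by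
      intro y hy
      rw [mem_preimage, Metric.mem_ball, dist_eq_norm, ← map_sub] at hy
      have hκi : κ⁻¹ * ρ < ρ := by
        have : κ⁻¹ < 1 := inv_lt_one_of_one_lt₀ hκ
        nlinarith
      have h1 : ‖y - extChartAt (𝓡 2) c x‖ < r₄ / 2 := by
        refine (hBs _).trans_lt ?_
        calc m * ‖B (y - extChartAt (𝓡 2) c x)‖ ≤ m * ρ := by gcongr; linarith
          _ < m * (r₄ / (2 * m)) := by gcongr
          _ = r₄ / 2 := by field_simp
      have hyb : y ∈ Metric.ball y₀ r₁ := by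
        rw [Metric.mem_ball] at hxφ ⊢
        rw [← dist_eq_norm] at h1
        linarith [dist_triangle y (extChartAt (𝓡 2) c x) y₀, min_le_left r₁ r₃]
      have hxb : extChartAt (𝓡 2) c x ∈ Metric.ball y₀ r₁ :=
        Metric.ball_subset_ball (by linarith [min_le_left r₁ r₃]) hxφ
      refine ⟨hr₁s hyb, ?_⟩
      have h2 := hD1 _ hxb y hyb
      rw [(extChartAt (𝓡 2) c).left_inv hxs, dist_comm] at h2
      rw [mem_preimage, Metric.mem_ball]
      refine h2.trans_lt ?_
      calc κ * ‖B (y - extChartAt (𝓡 2) c x)‖ < κ * (κ⁻¹ * ρ) := by gcongr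
        _ = ρ := by field_simp
    calc ENNReal.ofReal ((κ ^ 3)⁻¹ * (Real.pi * ρ ^ 2))
        = ENNReal.ofReal (κ⁻¹ * b) *
          volume (B ⁻¹' Metric.ball (B (extChartAt (𝓡 2) c x)) (κ⁻¹ * ρ)) := by
          rw [hBm, EuclideanSpace.volume_ball_fin_two, ← ENNReal.ofReal_pow (by positivity),
            ← ENNReal.ofReal_mul (by positivity), ← ENNReal.ofReal_mul (by positivity),
            ← ENNReal.ofReal_mul (by positivity)]
          congr 1
          field_simp
      _ ≤ ENNReal.ofReal (κ⁻¹ * b) * volume P := by gcongr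
      _ = ∫⁻ y in P, ENNReal.ofReal (κ⁻¹ * b) := (setLIntegral_const _ _).symm
      _ ≤ _ := setLIntegral_mono' hPm fun y hy => ENNReal.ofReal_le_ofReal (hPdens y hy).2.le

/-- On a compact surface, the area of small balls is asymptotic to the Euclidean one, uniformly in
the centre of the ball. -/
theorem exists_volume_ball_bounds [CompactSpace M] {κ : ℝ} (hκ : 1 < κ) :
    ∃ r > 0, ∀ x : M, ∀ ρ : ℝ, 0 < ρ → ρ < r →
      riemannianVolume M (Metric.ball x ρ) ≤ ENNReal.ofReal (κ ^ 3 * (Real.pi * ρ ^ 2)) ∧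
      ENNReal.ofReal ((κ ^ 3)⁻¹ * (Real.pi * ρ ^ 2)) ≤ riemannianVolume M (Metric.ball x ρ) := by
  have key : ∀ᶠ ρ in 𝓝 (0 : ℝ), ∀ x ∈ (univ : Set M), 0 < ρ →
      riemannianVolume M (Metric.ball x ρ) ≤ ENNReal.ofReal (κ ^ 3 * (Real.pi * ρ ^ 2)) ∧
      ENNReal.ofReal ((κ ^ 3)⁻¹ * (Real.pi * ρ ^ 2)) ≤ riemannianVolume M (Metric.ball x ρ) := by
    refine isCompact_univ.eventually_forall_of_forall_eventually fun c _ => ?_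
    obtain ⟨r, hr, h⟩ := exists_volume_ball_bounds_near c hκ
    filter_upwards [prod_mem_nhds (Iio_mem_nhds hr) (Metric.ball_mem_nhds c hr)] with z hz hz0
    exact h z.2 hz.2 z.1 hz0 hz.1
  obtain ⟨r, hr, h⟩ := Metric.eventually_nhds_iff.1 key
  exact ⟨r, hr, fun x ρ hρ hρr => h (by simpa [abs_of_pos hρ] using hρr) x (mem_univ x) hρ⟩

end Volume

/-! ### Locally Lipschitz functions on open subsets of the plane -/

section PlaneLipschitz

variable {T : Set Plane} {f : Plane → ℝ}

theorem exists_lipschitzOnWith_nhds (hT : IsOpen T) (hf : LocallyLipschitzOn T f) {y : Plane}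
    (hy : y ∈ T) : ∃ K, ∃ t ∈ 𝓝 y, LipschitzOnWith K f t := by
  obtain ⟨K, t, ht, h⟩ := hf hy
  rw [hT.nhdsWithin_eq hy] at ht
  exact ⟨K, t, ht, h⟩

/-- Rademacher's theorem for locally Lipschitz functions on an open set. -/
theorem ae_differentiableAt_of_locallyLipschitzOn (hT : IsOpen T) (hf : LocallyLipschitzOn T f) :
    ∀ᵐ y, y ∈ T → DifferentiableAt ℝ f y := by
  rw [ae_iff]
  refine measure_null_of_locally_null _ fun y hy => ?_
  simp only [mem_ofPred_eq, Classical.not_imp] at hy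
  obtain ⟨K, t, ht, hK⟩ := exists_lipschitzOnWith_nhds hT hf hy.1
  obtain ⟨s, hst, hso, hys⟩ := mem_nhds_iff.1 ht
  have h := (hK.mono hst).ae_differentiableWithinAt_of_mem (μ := (volume : Measure Plane))
  refine ⟨s ∩ {y | ¬(y ∈ T → DifferentiableAt ℝ f y)}, inter_comm s _ ▸
    inter_mem_nhdsWithin _ (hso.mem_nhds hys), measure_mono_null ?_ (ae_iff.1 h)⟩
  rintro z ⟨hzs, hz⟩
  simp only [mem_ofPred_eq, Classical.not_imp] at hz ⊢
  exact ⟨hzs, fun h => hz.2 (h.differentiableAt (hso.mem_nhds hzs))⟩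

theorem locallyIntegrableOn_fderiv (hT : IsOpen T) (hf : LocallyLipschitzOn T f) (v : Plane) :
    LocallyIntegrableOn (fun y => fderiv ℝ f y v) T := by
  intro y hy
  obtain ⟨K, t, ht, hK⟩ := exists_lipschitzOnWith_nhds hT hf hy
  obtain ⟨r, hr, hrt⟩ := Metric.mem_nhds_iff.1 ht
  refine ⟨Metric.ball y r, mem_nhdsWithin_of_mem_nhds (Metric.ball_mem_nhds y hr), ?_⟩
  refine Measure.integrableOn_of_bounded (M := K * ‖v‖) measure_ball_lt_top.ne
    (measurable_fderiv_apply_const ℝ f v).aestronglyMeasurable ?_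
  refine ae_restrict_of_forall_mem measurableSet_ball fun z hz => ?_
  refine ((fderiv ℝ f z).le_opNorm v).trans ?_
  gcongr
  exact norm_fderiv_le_of_lipschitzOn ℝ (Metric.isOpen_ball.mem_nhds hz) (hK.mono hrt)

/-- Integration by parts for locally Lipschitz functions. -/
theorem setIntegral_mul_fderiv_eq (hT : IsOpen T) (hf : LocallyLipschitzOn T f) (v : Plane)
    {ψ : Plane → ℝ} (hψ : ContDiff ℝ ∞ ψ) (hψc : HasCompactSupport ψ) (hψT : tsupport ψ ⊆ T) :
    ∫ y in T, f y * fderiv ℝ ψ y v = -∫ y in T, fderiv ℝ f y v * ψ y := by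
  -- On a compact neighbourhood of the support of ψ, `f` is Lipschitz and extends to a globally
  -- Lipschitz `g`. Integration by parts for `g` suffices, since the two agree near the support.
  obtain ⟨K', hK'c, hK'1, hK'2⟩ := exists_compact_between hψc hT hψT
  obtain ⟨K, hK⟩ := (hf.mono hK'2).exists_lipschitzOnWith_of_compact hK'c
  obtain ⟨g, hg, hfg⟩ := hK.extend_real
  obtain ⟨D, hD⟩ := (hψ.of_le (by simp) : ContDiff ℝ 1 ψ).lipschitzWith_of_hasCompactSupport hψc
    one_ne_zero
  have key := hg.integral_lineDeriv_mul_eq (μ := (volume : Measure Plane)) hD hψc v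
  have e1 : ∀ y, f y * fderiv ℝ ψ y v = -(lineDeriv ℝ ψ y (-v) * g y) := by
    intro y
    rw [(hψ.differentiable (by simp) y).lineDeriv_eq_fderiv, map_neg]
    by_cases hy : y ∈ tsupport ψ
    · rw [hfg (interior_subset (hK'1 hy))]
      ring
    · have : fderiv ℝ ψ y = 0 := by
        by_contra h
        exact hy (support_fderiv_subset ℝ h)
      simp [this]
  have hae : ∀ᵐ y, lineDeriv ℝ g y v * ψ y = fderiv ℝ f y v * ψ y := by
    filter_upwards [hg.ae_differentiableAt (μ := (volume : Measure Plane))] with y hy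
    by_cases hyt : y ∈ tsupport ψ
    · have hev : f =ᶠ[𝓝 y] g := by
        filter_upwards [isOpen_interior.mem_nhds (hK'1 hyt)] with z hz
          using hfg (interior_subset hz)
      rw [hy.lineDeriv_eq_fderiv, hev.fderiv_eq]
    · simp [image_eq_zero_of_notMem_tsupport hyt]
  rw [setIntegral_eq_integral_of_forall_compl_eq_zero,
    setIntegral_eq_integral_of_forall_compl_eq_zero,
    ← integral_congr_ae hae, key, ← integral_neg]
  · exact integral_congr_ae (ae_of_all _ e1)
  · intro y hy
    simp [image_eq_zero_of_notMem_tsupport fun h => hy (hψT h)]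
  · intro y hy
    have : fderiv ℝ ψ y = 0 := by
      by_contra h
      exact hy (hψT (support_fderiv_subset ℝ h))
    simp [this]

end PlaneLipschitz

/-! ### The pointwise gradient -/

section Gradient

variable {M : Type*} [MetricSpace M] [ChartedSpace Plane M]
  [RiemannianBundle (fun x : M => TangentSpace (𝓡 2) x)]

theorem exists_inner_eq {x : M} (L : TangentSpace (𝓡 2) x →ₗ[ℝ] ℝ) :
    ∃ X : TangentSpace (𝓡 2) x, ∀ w, inner ℝ X w = L w := by
  -- The inner product is the Riemannian one, so only the linear structure comes from `Plane`;
  -- finite dimension then supplies the completeness and continuity that Riesz representation needs.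
  have : FiniteDimensional ℝ (TangentSpace (𝓡 2) x) :=
    inferInstanceAs (FiniteDimensional ℝ Plane)
  have : CompleteSpace (TangentSpace (𝓡 2) x) := FiniteDimensional.complete ℝ _
  exact ⟨(InnerProductSpace.toDual ℝ (TangentSpace (𝓡 2) x)).symm
    (LinearMap.toContinuousLinearMap L), fun w => by simp⟩

/-- The gradient of a function, through its differential (zero where there is none). -/
noncomputable def pointGradient (u : M → ℝ) (x : M) : TangentSpace (𝓡 2) x :=
  (exists_inner_eq (x := x) (mfderiv (𝓡 2) 𝓘(ℝ, ℝ) u x).toLinearMap).choose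

theorem inner_pointGradient (u : M → ℝ) (x : M) (w : TangentSpace (𝓡 2) x) :
    inner ℝ (pointGradient u x) w = mfderiv (𝓡 2) 𝓘(ℝ, ℝ) u x w :=
  (exists_inner_eq (x := x) (mfderiv (𝓡 2) 𝓘(ℝ, ℝ) u x).toLinearMap).choose_spec w

variable [IsManifold (𝓡 2) ∞ M]

theorem inner_pointGradient_coordVector {u : M → ℝ} {c : M} {y : Plane}
    (hy : y ∈ (extChartAt (𝓡 2) c).target)
    (hd : DifferentiableAt ℝ (fun y => u ((extChartAt (𝓡 2) c).symm y)) y) (v : Plane) :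
    inner ℝ (pointGradient u ((extChartAt (𝓡 2) c).symm y)) (coordVector c v y) =
      fderiv ℝ (fun y => u ((extChartAt (𝓡 2) c).symm y)) y v := by
  rw [inner_pointGradient]
  set p := (extChartAt (𝓡 2) c).symm y with hp
  have hps : p ∈ (extChartAt (𝓡 2) c).source := (extChartAt (𝓡 2) c).map_target hy
  have hu : MDifferentiableAt (𝓡 2) 𝓘(ℝ, ℝ) u p := by
    have h1 : MDifferentiableAt (𝓡 2) 𝓘(ℝ, ℝ)
        ((fun y => u ((extChartAt (𝓡 2) c).symm y)) ∘ extChartAt (𝓡 2) c) p := by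
      refine MDifferentiableAt.comp (I' := 𝓘(ℝ, Plane)) p ?_
        (mdifferentiableAt_extChartAt (by simpa using hps))
      rw [hp, (extChartAt (𝓡 2) c).right_inv hy]
      exact hd.mdifferentiableAt
    refine h1.congr_of_eventuallyEq ?_
    filter_upwards [(isOpen_extChartAt_source (I := 𝓡 2) c).mem_nhds hps] with q hq
    rw [Function.comp, (extChartAt (𝓡 2) c).left_inv hq]
  have h := mfderiv_comp_apply (I' := 𝓡 2) (g := u) y hu (mdifferentiableAt_symm hy) v
  rw [mfderiv_eq_fderiv] at h
  exact h.symm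

theorem coordVector_surjective {c : M} {y : Plane} (hy : y ∈ (extChartAt (𝓡 2) c).target)
    (X : TangentSpace (𝓡 2) ((extChartAt (𝓡 2) c).symm y)) : ∃ v, coordVector c v y = X :=
  ⟨_, coordVector_mfderiv hy X⟩

variable [IsContinuousRiemannianBundle Plane (fun x : M => TangentSpace (𝓡 2) x)]
  [IsRiemannianManifold (𝓡 2) M]

/-- The inverse chart is locally Lipschitz by `exists_dist_symm_le`; any κ > 1 would do in place of
2. -/
theorem locallyLipschitzOn_comp_symm {u : M → ℝ} {K : NNReal} (hu : LipschitzWith K u) (c : M) :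
    LocallyLipschitzOn (extChartAt (𝓡 2) c).target
      (fun y => u ((extChartAt (𝓡 2) c).symm y)) := by
  intro y hy
  obtain ⟨B, -, hB⟩ := exists_orthonormal_frame hy
  obtain ⟨r, hr, -, hD⟩ := exists_dist_symm_le hy hB one_lt_two
  refine ⟨K * (2 * ‖(B : Plane →L[ℝ] Plane)‖₊), Metric.ball y r,
    mem_nhdsWithin_of_mem_nhds (Metric.ball_mem_nhds y hr),
    LipschitzOnWith.of_dist_le_mul fun z hz z' hz' => ?_⟩
  refine (hu.dist_le_mul _ _).trans ?_
  rw [NNReal.coe_mul, mul_assoc]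
  gcongr
  refine (hD z hz z' hz').trans ?_
  rw [NNReal.coe_mul, mul_assoc, dist_comm z z', dist_eq_norm]
  have := (B : Plane →L[ℝ] Plane).le_opNorm (z' - z)
  simpa using this

/-- The gradient is bounded by the local Lipschitz constant. -/
theorem norm_pointGradient_le {u : M → ℝ} {c : M} {y : Plane}
    (hy : y ∈ (extChartAt (𝓡 2) c).target)
    (hd : DifferentiableAt ℝ (fun y => u ((extChartAt (𝓡 2) c).symm y)) y) {C : ℝ} (hC : 0 ≤ C)
    (h : ∀ ε > 0, ∀ᶠ x in 𝓝 ((extChartAt (𝓡 2) c).symm y),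
      |u x - u ((extChartAt (𝓡 2) c).symm y)| ≤
        (C + ε) * dist x ((extChartAt (𝓡 2) c).symm y)) :
    ‖pointGradient u ((extChartAt (𝓡 2) c).symm y)‖ ≤ C := by
  set f := fun y => u ((extChartAt (𝓡 2) c).symm y) with hf
  -- Differentiation along the line y + tv. Taking ε = κ - 1 ties both losses to one parameter, so a
  -- single limit κ → 1 removes them.
  have key₁ : ∀ v, ∀ κ : ℝ, 1 < κ →
      |fderiv ℝ f y v| ≤ (C + (κ - 1)) * (κ * ‖coordVector c v y‖) := by
    intro v κ hκ
    have hκ1 : 0 < κ - 1 := by linarith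
    have hκ0 : 0 < κ := by linarith
    obtain ⟨B, -, hB⟩ := exists_orthonormal_frame hy
    obtain ⟨r, hr, -, hD⟩ := exists_dist_symm_le hy hB hκ
    have hline : HasDerivAt (fun t : ℝ => y + t • v) v 0 := by
      have h := ((hasDerivAt_id (0 : ℝ)).smul_const v).const_add y
      rw [one_smul] at h
      exact h
    have hl0 : y + (0 : ℝ) • v = y := by simp
    have hg : HasDerivAt (fun t : ℝ => f (y + t • v)) (fderiv ℝ f y v) 0 := by
      have h1 : HasFDerivAt f (fderiv ℝ f y) (y + (0 : ℝ) • v) := by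
        rw [hl0]
        exact hd.hasFDerivAt
      exact h1.comp_hasDerivAt (0 : ℝ) hline
    have ht : Tendsto (fun t : ℝ => y + t • v) (𝓝 0) (𝓝 y) := by
      have := hline.continuousAt.tendsto
      rwa [hl0] at this
    refine hg.le_of_lip' (by positivity) ?_
    filter_upwards [ht (Metric.ball_mem_nhds y hr),
      ((continuousAt_extChartAt_symm'' hy).tendsto.comp ht).eventually (h _ hκ1)] with t ht1 ht2
    rw [hl0, Real.norm_eq_abs]
    refine ht2.trans ?_
    rw [mul_assoc (C + (κ - 1))]
    gcongr
    rw [dist_comm]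
    refine (hD y (Metric.mem_ball_self hr) _ ht1).trans (le_of_eq ?_)
    rw [add_sub_cancel_left, map_smul, norm_smul, hB, sub_zero]
    ring
  have key : ∀ v, |fderiv ℝ f y v| ≤ C * ‖coordVector c v y‖ := by
    intro v
    have hlim : Tendsto (fun κ : ℝ => (C + (κ - 1)) * (κ * ‖coordVector c v y‖)) (𝓝[>] 1)
        (𝓝 ((C + (1 - 1)) * (1 * ‖coordVector c v y‖))) :=
      (Continuous.tendsto (by fun_prop) 1).mono_left nhdsWithin_le_nhds
    rw [sub_self, add_zero, one_mul] at hlim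
    exact ge_of_tendsto hlim (by filter_upwards [self_mem_nhdsWithin] with κ hκ using key₁ v κ hκ)
  -- Testing against the gradient itself gives ‖X‖² ≤ C‖X‖.
  obtain ⟨v, hv⟩ := coordVector_surjective hy (pointGradient u ((extChartAt (𝓡 2) c).symm y))
  have h1 := inner_pointGradient_coordVector hy hd v
  rw [hv, real_inner_self_eq_norm_sq] at h1
  have h2 := key v
  rw [hv, ← h1, abs_of_nonneg (sq_nonneg _)] at h2
  by_contra hlt
  push Not at hlt
  nlinarith

end Gradient

/-! ### Weak gradients of Lipschitz functions -/

section WeakGradient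

variable {M : Type*} [MetricSpace M] [ChartedSpace Plane M]
  [RiemannianBundle (fun x : M => TangentSpace (𝓡 2) x)]
  [MeasurableSpace M] [BorelSpace M] [IsManifold (𝓡 2) ∞ M]
  [IsContinuousRiemannianBundle Plane (fun x : M => TangentSpace (𝓡 2) x)]
  [IsRiemannianManifold (𝓡 2) M]

/-- A property that holds almost everywhere in coordinates holds almost everywhere on the domain
of the chart. -/
theorem ae_of_ae_chart {c : M} {P : M → Prop}
    (h : ∀ᵐ y, y ∈ (extChartAt (𝓡 2) c).target → P ((extChartAt (𝓡 2) c).symm y)) :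
    ∀ᵐ x ∂(riemannianVolume M), x ∈ (extChartAt (𝓡 2) c).source → P x := by
  set Z := {y | ¬(y ∈ (extChartAt (𝓡 2) c).target → P ((extChartAt (𝓡 2) c).symm y))} with hZ
  have hZ0 : volume (toMeasurable volume Z) = 0 := by
    rw [measure_toMeasurable]
    exact ae_iff.1 h
  set S := (extChartAt (𝓡 2) c).source ∩ extChartAt (𝓡 2) c ⁻¹' toMeasurable volume Z with hS
  have hSm : MeasurableSet S := by
    have h1 : Measurable ((extChartAt (𝓡 2) c).source.domRestrict (extChartAt (𝓡 2) c)) :=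
      (continuousOn_iff_continuous_domRestrict.1 (continuousOn_extChartAt c)).measurable
    have h2 := (isOpen_extChartAt_source (I := 𝓡 2) c).measurableSet.subtype_image
      (h1 (measurableSet_toMeasurable volume Z))
    convert h2 using 1
    ext y
    simp only [hS, mem_inter_iff, mem_preimage, mem_image, Subtype.exists,
      domRestrict_apply, exists_and_right, exists_eq_right]
    exact ⟨fun h => ⟨h.1, h.2⟩, fun ⟨h1, h2⟩ => ⟨h1, h2⟩⟩
  have hS0 : riemannianVolume M S = 0 := by
    rw [riemannianVolume_eq_chartVolume hSm inter_subset_left, chartVolume_apply c hSm]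
    refine setLIntegral_measure_zero _ _ (measure_mono_null ?_ hZ0)
    rintro y ⟨hy, -, hy'⟩
    rwa [mem_preimage, (extChartAt (𝓡 2) c).right_inv hy] at hy'
  refine ae_iff.2 (measure_mono_null (fun x hx => ?_) hS0)
  simp only [mem_ofPred_eq, Classical.not_imp] at hx
  refine ⟨hx.1, subset_toMeasurable _ _ ?_⟩
  simp only [hZ, mem_ofPred_eq, Classical.not_imp]
  refine ⟨(extChartAt (𝓡 2) c).map_source hx.1, ?_⟩
  rw [(extChartAt (𝓡 2) c).left_inv hx.1]
  exact hx.2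

theorem ae_of_forall_ae_chart [CompactSpace M] {P : M → Prop}
    (h : ∀ c : M, ∀ᵐ y, y ∈ (extChartAt (𝓡 2) c).target → P ((extChartAt (𝓡 2) c).symm y)) :
    ∀ᵐ x ∂(riemannianVolume M), P x := by
  rw [ae_iff]
  refine measure_null_of_locally_null _ fun c _ => ?_
  refine ⟨(extChartAt (𝓡 2) c).source ∩ {x | ¬P x}, inter_comm _ {x | ¬P x} ▸
    inter_mem_nhdsWithin _ (extChartAt_source_mem_nhds c), ?_⟩
  refine measure_mono_null (fun x hx => ?_) (ae_iff.1 (ae_of_ae_chart (h c)))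
  simpa using hx

/-- Weak gradients are unique up to null sets. -/
theorem IsWeakGradient.ae_eq [CompactSpace M] {u : M → ℝ}
    {X X' : ∀ x : M, TangentSpace (𝓡 2) x} (h : IsWeakGradient u X) (h' : IsWeakGradient u X') :
    ∀ᵐ x ∂(riemannianVolume M), X x = X' x := by
  refine ae_of_forall_ae_chart fun c => ?_
  -- The fundamental lemma of the calculus of variations, with a null set depending on `v`. Using
  -- only the two basis vectors and linearity avoids an uncountable union.
  have key : ∀ v : Plane, ∀ᵐ y, y ∈ (extChartAt (𝓡 2) c).target →
      inner ℝ (X ((extChartAt (𝓡 2) c).symm y)) (coordVector c v y) -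
        inner ℝ (X' ((extChartAt (𝓡 2) c).symm y)) (coordVector c v y) = 0 := by
    intro v
    obtain ⟨h1, h2⟩ := (h c).2 v
    obtain ⟨h1', h2'⟩ := (h' c).2 v
    refine (isOpen_target c).ae_eq_zero_of_integral_contDiff_smul_eq_zero (h1.sub h1')
      fun ψ hψ hψc hψT => ?_
    have e : ∀ y, ψ y • (inner ℝ (X ((extChartAt (𝓡 2) c).symm y)) (coordVector c v y) -
        inner ℝ (X' ((extChartAt (𝓡 2) c).symm y)) (coordVector c v y)) =
        inner ℝ (X ((extChartAt (𝓡 2) c).symm y)) (coordVector c v y) * ψ y -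
          inner ℝ (X' ((extChartAt (𝓡 2) c).symm y)) (coordVector c v y) * ψ y := by
      intro y
      rw [smul_eq_mul]
      ring
    have hint : ∀ g : Plane → ℝ, LocallyIntegrableOn g (extChartAt (𝓡 2) c).target →
        IntegrableOn (fun y => g y * ψ y) (extChartAt (𝓡 2) c).target := by
      intro g hg
      have h3 : IntegrableOn g (tsupport ψ) := hg.integrableOn_compact_subset hψT hψc
      have h4 : IntegrableOn (fun y => g y * ψ y) (tsupport ψ) :=
        h3.mul_continuousOn hψ.continuous.continuousOn hψc
      refine (integrableOn_iff_integrable_of_support_subset ?_).1 h4 |>.integrableOn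
      exact (Function.support_mul_subset_right _ _).trans (subset_tsupport ψ)
    rw [integral_congr_ae (ae_of_all _ e), ← setIntegral_eq_integral_of_forall_compl_eq_zero
      (s := (extChartAt (𝓡 2) c).target), integral_sub (hint _ h1) (hint _ h1')]
    · linarith [h2 ψ hψ hψc hψT, h2' ψ hψ hψc hψT]
    · intro y hy
      simp [image_eq_zero_of_notMem_tsupport fun h => hy (hψT h)]
  filter_upwards [key (EuclideanSpace.single 0 1), key (EuclideanSpace.single 1 1)] with y h0 h1 hy
  obtain ⟨v, hv⟩ := coordVector_surjective hy
    (X ((extChartAt (𝓡 2) c).symm y) - X' ((extChartAt (𝓡 2) c).symm y))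
  have h2 : inner ℝ (X ((extChartAt (𝓡 2) c).symm y) - X' ((extChartAt (𝓡 2) c).symm y))
      (coordVector c v y) = 0 := by
    rw [plane_eq_add v, coordVector_add, coordVector_smul, coordVector_smul, inner_add_right,
      real_inner_smul_right, real_inner_smul_right, inner_sub_left, inner_sub_left, h0 hy, h1 hy]
    ring
  rw [hv, inner_self_eq_zero, sub_eq_zero] at h2
  exact h2

/-- In coordinates `u` is locally Lipschitz, so by Rademacher the classical differential exists
almost everywhere and integrates by parts. -/
theorem isWeakGradient_pointGradient {u : M → ℝ} {K : NNReal} (hu : LipschitzWith K u) :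
    IsWeakGradient u (pointGradient u) := by
  intro c
  have hT := isOpen_target c
  have hL := locallyLipschitzOn_comp_symm hu c
  have hcont : ContinuousOn (fun y => u ((extChartAt (𝓡 2) c).symm y))
      (extChartAt (𝓡 2) c).target :=
    hu.continuous.comp_continuousOn (continuousOn_extChartAt_symm c)
  refine ⟨hcont.locallyIntegrableOn hT.measurableSet, fun v => ?_⟩
  have hae : ∀ᵐ y ∂(volume.restrict (extChartAt (𝓡 2) c).target),
      fderiv ℝ (fun y => u ((extChartAt (𝓡 2) c).symm y)) y v =
      inner ℝ (pointGradient u ((extChartAt (𝓡 2) c).symm y)) (coordVector c v y) := by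
    rw [ae_restrict_iff' hT.measurableSet]
    filter_upwards [ae_differentiableAt_of_locallyLipschitzOn hT hL] with y hy hyT
    exact (inner_pointGradient_coordVector hyT (hy hyT) v).symm
  refine ⟨?_, fun ψ hψ hψc hψT => ?_⟩
  · have h1 := locallyIntegrableOn_fderiv hT hL v
    intro y hy
    obtain ⟨s, hs, hsi⟩ := h1 y hy
    refine ⟨s ∩ (extChartAt (𝓡 2) c).target, inter_mem hs self_mem_nhdsWithin, ?_⟩
    refine (hsi.mono_set inter_subset_left).congr_fun_ae ?_
    exact ae_mono (Measure.restrict_mono inter_subset_right le_rfl) hae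
  · rw [setIntegral_mul_fderiv_eq hT hL v hψ hψc hψT]
    congr 1
    refine integral_congr_ae ?_
    filter_upwards [hae] with y hy
    rw [hy]

/-- The formula ‖X‖² = aᵀ G⁻¹ a, written out. It exhibits the gradient norm as a measurable
expression in the metric and the partial derivatives. -/
theorem chartForm_self_eq_of_inner {c : M} {y : Plane}
    (hy : y ∈ (extChartAt (𝓡 2) c).target) (X : TangentSpace (𝓡 2) ((extChartAt (𝓡 2) c).symm y))
    {a₀ a₁ : ℝ} (h0 : inner ℝ X (coordVector c (EuclideanSpace.single 0 1) y) = a₀)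
    (h1 : inner ℝ X (coordVector c (EuclideanSpace.single 1 1) y) = a₁) :
    ‖X‖ ^ 2 = (gramMatrix c y 1 1 * a₀ ^ 2 - 2 * gramMatrix c y 0 1 * a₀ * a₁
      + gramMatrix c y 0 0 * a₁ ^ 2) /
      (gramMatrix c y 0 0 * gramMatrix c y 1 1 - gramMatrix c y 0 1 ^ 2) := by
  obtain ⟨v, rfl⟩ := coordVector_surjective hy X
  have hD := gramMatrix_det_pos hy
  rw [Matrix.det_fin_two, gramMatrix_symm, ← sq] at hD
  change chartForm c y v _ = _ at h0
  change chartForm c y v _ = _ at h1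
  rw [← chartForm_self, eq_div_iff hD.ne', ← h0, ← h1]
  simp only [chartForm_eq_gram, gramMatrix_symm]
  simp
  ring

/-- The gradient is chosen point by point, so measurability has to come from the explicit coordinate
formula, valid almost everywhere in each chart; countably many charts cover. -/
theorem aestronglyMeasurable_norm_pointGradient [CompactSpace M] {u : M → ℝ} {K : NNReal}
    (hu : LipschitzWith K u) :
    AEStronglyMeasurable (fun x => ‖pointGradient u x‖) (riemannianVolume M) := by
  have hloc : ∀ c : M, AEMeasurable (fun x => ‖pointGradient u x‖)
      ((riemannianVolume M).restrict (extChartAt (𝓡 2) c).source) := by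
    intro c
    have hT := isOpen_target c
    set T := (extChartAt (𝓡 2) c).target
    set f := fun y => u ((extChartAt (𝓡 2) c).symm y)
    have hG : ∀ i j, Measurable (T.indicator fun y => gramMatrix c y i j) := by
      intro i j
      have h1 : ContinuousOn (fun y => gramMatrix c y i j) T :=
        continuousOn_pi.1 (continuousOn_pi.1 (continuousOn_gramMatrix c) i) j
      classical
      rw [← piecewise_eq_indicator]
      exact h1.measurable_piecewise (continuous_const (y := (0 : ℝ))).continuousOn hT.measurableSet
    have ha : ∀ i : Fin 2, Measurable fun y => fderiv ℝ f y (EuclideanSpace.single i 1) :=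
      fun i => measurable_fderiv_apply_const ℝ f _
    set F : Plane → ℝ := fun y => Real.sqrt
      ((T.indicator (fun y => gramMatrix c y 1 1) y * fderiv ℝ f y (EuclideanSpace.single 0 1) ^ 2
        - 2 * T.indicator (fun y => gramMatrix c y 0 1) y *
          fderiv ℝ f y (EuclideanSpace.single 0 1) * fderiv ℝ f y (EuclideanSpace.single 1 1)
        + T.indicator (fun y => gramMatrix c y 0 0) y *
          fderiv ℝ f y (EuclideanSpace.single 1 1) ^ 2) /
        (T.indicator (fun y => gramMatrix c y 0 0) y * T.indicator (fun y => gramMatrix c y 1 1) y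
          - T.indicator (fun y => gramMatrix c y 0 1) y ^ 2)) with hF
    have hFm : Measurable F := by
      have := hG 0 0
      have := hG 0 1
      have := hG 1 1
      have := ha 0
      have := ha 1
      fun_prop
    have hφ : AEMeasurable (extChartAt (𝓡 2) c)
        ((riemannianVolume M).restrict (extChartAt (𝓡 2) c).source) :=
      (continuousOn_extChartAt c).aemeasurable (isOpen_extChartAt_source c).measurableSet
    refine (hFm.comp_aemeasurable hφ).congr ?_
    have hae : ∀ᵐ y, y ∈ T → F (extChartAt (𝓡 2) c ((extChartAt (𝓡 2) c).symm y)) =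
        ‖pointGradient u ((extChartAt (𝓡 2) c).symm y)‖ := by
      filter_upwards [ae_differentiableAt_of_locallyLipschitzOn hT
        (locallyLipschitzOn_comp_symm hu c)] with y hy hyT
      rw [(extChartAt (𝓡 2) c).right_inv hyT, hF]
      simp only [indicator_of_mem hyT]
      rw [← chartForm_self_eq_of_inner hyT (pointGradient u ((extChartAt (𝓡 2) c).symm y))
        (inner_pointGradient_coordVector hyT (hy hyT) _)
        (inner_pointGradient_coordVector hyT (hy hyT) _), Real.sqrt_sq (norm_nonneg _)]
    have := ae_of_ae_chart (P := fun x => F (extChartAt (𝓡 2) c x) = ‖pointGradient u x‖) hae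
    exact (ae_restrict_iff' (isOpen_extChartAt_source c).measurableSet).2 this
  obtain ⟨s, hs, hsu⟩ := TopologicalSpace.countable_cover_nhds
    (f := fun c : M => (extChartAt (𝓡 2) c).source) extChartAt_source_mem_nhds
  have := hs.to_subtype
  rw [biUnion_eq_iUnion] at hsu
  have h1 := AEMeasurable.iUnion (fun c : s => hloc c)
  rw [hsu, Measure.restrict_univ] at h1
  exact h1.aestronglyMeasurable

variable [CompactSpace M]

/-- Lipschitz functions belong to the Sobolev space. -/
theorem memH1_of_lipschitzWith [IsFiniteMeasure (riemannianVolume M)] {u : M → ℝ} {K : NNReal}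
    (hu : LipschitzWith K u) : MemH1 u := by
  refine ⟨?_, pointGradient u, isWeakGradient_pointGradient hu, ?_⟩
  · obtain ⟨C, hC⟩ := (isCompact_range hu.continuous).isBounded.exists_norm_le
    exact MemLp.of_bound hu.continuous.aestronglyMeasurable C
      (ae_of_all _ fun x => hC _ (mem_range_self x))
  · refine MemLp.of_bound (aestronglyMeasurable_norm_pointGradient hu) K ?_
    refine ae_of_forall_ae_chart fun c => ?_
    filter_upwards [ae_differentiableAt_of_locallyLipschitzOn (isOpen_target c)
        (locallyLipschitzOn_comp_symm hu c)] with y hy hyT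
    rw [norm_norm]
    refine norm_pointGradient_le hyT (hy hyT) K.2 fun ε hε => Eventually.of_forall fun x => ?_
    have := hu.dist_le_mul x ((extChartAt (𝓡 2) c).symm y)
    rw [Real.dist_eq] at this
    refine this.trans ?_
    gcongr
    exact le_add_of_nonneg_right hε.le

/-- The Dirichlet integral is bounded by the integral of any bound for the square of the local
Lipschitz constant. -/
theorem integral_norm_weakGradient_sq_le {u : M → ℝ} {K : NNReal} (hu : LipschitzWith K u)
    {g : M → ℝ} (hg : Integrable g (riemannianVolume M))
    (h : ∀ x, ∃ C, 0 ≤ C ∧ C ^ 2 ≤ g x ∧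
      ∀ ε > 0, ∀ᶠ x' in 𝓝 x, |u x' - u x| ≤ (C + ε) * dist x' x) :
    ∫ x, ‖weakGradient u x‖ ^ 2 ∂(riemannianVolume M) ≤ ∫ x, g x ∂(riemannianVolume M) := by
  have hex : ∃ X : ∀ x : M, TangentSpace (𝓡 2) x, IsWeakGradient u X :=
    ⟨_, isWeakGradient_pointGradient hu⟩
  -- `weakGradient` is an arbitrary choice, replaced almost everywhere by `pointGradient` through
  -- uniqueness.
  have hw : IsWeakGradient u (weakGradient u) := by
    rw [weakGradient, dif_pos hex]
    exact hex.choose_spec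
  have hae := hw.ae_eq (isWeakGradient_pointGradient hu)
  refine integral_mono_of_nonneg (ae_of_all _ fun x => sq_nonneg _) hg ?_
  have hb : ∀ᵐ x ∂(riemannianVolume M), ‖pointGradient u x‖ ^ 2 ≤ g x := by
    refine ae_of_forall_ae_chart fun c => ?_
    filter_upwards [ae_differentiableAt_of_locallyLipschitzOn (isOpen_target c)
        (locallyLipschitzOn_comp_symm hu c)] with y hy hyT
    obtain ⟨C, hC0, hC, hC'⟩ := h ((extChartAt (𝓡 2) c).symm y)
    refine le_trans ?_ hC
    gcongr
    exact norm_pointGradient_le hyT (hy hyT) hC0 hC'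
  filter_upwards [hae, hb] with x h1 h2
  rwa [h1]

end WeakGradient

/-! ### Pointwise estimates for bubbles -/

section Bubble

theorem hasDerivAt_log_one_add_sq (a r : ℝ) :
    HasDerivAt (fun r : ℝ => Real.log (1 + a ^ 2 * r ^ 2))
      (2 * a ^ 2 * r / (1 + a ^ 2 * r ^ 2)) r := by
  have h : HasDerivAt (fun r : ℝ => 1 + a ^ 2 * r ^ 2) (a ^ 2 * (2 * r)) r := by
    simpa using (((hasDerivAt_id r).pow 2).const_mul (a ^ 2)).const_add 1
  convert h.log (by positivity) using 1
  ring

/-- The derivative 2a²r/(1+a²r²) is at most a in absolute value, by 2a|r| ≤ 1 + a²r². -/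
theorem abs_log_one_add_sq_sub_le {a : ℝ} (ha : 0 ≤ a) (r r' : ℝ) :
    |Real.log (1 + a ^ 2 * r' ^ 2) - Real.log (1 + a ^ 2 * r ^ 2)| ≤ a * |r' - r| := by
  refine convex_univ.norm_image_sub_le_of_norm_hasDerivWithin_le (𝕜 := ℝ)
    (fun z _ => (hasDerivAt_log_one_add_sq a z).hasDerivWithinAt) (fun z _ => ?_)
    (mem_univ r) (mem_univ r')
  rw [Real.norm_eq_abs, abs_div, abs_of_pos (by positivity : 0 < 1 + a ^ 2 * z ^ 2),
    div_le_iff₀ (by positivity), abs_mul, abs_of_nonneg (by positivity : 0 ≤ 2 * a ^ 2)]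
  rw [← sq_abs z]
  nlinarith [mul_nonneg ha (sq_nonneg (a * |z| - 1))]

theorem eventually_abs_log_one_add_sq_sub_le (a r : ℝ) {ε : ℝ} (hε : 0 < ε) :
    ∀ᶠ r' in 𝓝 r, |Real.log (1 + a ^ 2 * r' ^ 2) - Real.log (1 + a ^ 2 * r ^ 2)| ≤
      (|2 * a ^ 2 * r / (1 + a ^ 2 * r ^ 2)| + ε) * |r' - r| := by
  filter_upwards [(hasDerivAt_iff_isLittleO.1 (hasDerivAt_log_one_add_sq a r)).def hε] with r' h
  rw [Real.norm_eq_abs, Real.norm_eq_abs, smul_eq_mul] at h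
  have h1 := abs_sub_abs_le_abs_sub (Real.log (1 + a ^ 2 * r' ^ 2) - Real.log (1 + a ^ 2 * r ^ 2))
    ((r' - r) * (2 * a ^ 2 * r / (1 + a ^ 2 * r ^ 2)))
  rw [abs_mul] at h1
  nlinarith

variable {M : Type*} [MetricSpace M] {k : ℕ}

/-- The logarithm of a convex combination of bubbles with the parameter `a`. -/
noncomputable def bubble (a : ℝ) (t : Fin k → ℝ) (p : Fin k → M) (x : M) : ℝ :=
  Real.log (∑ i, t i * (1 / (1 + a ^ 2 * dist x (p i) ^ 2)) ^ 2)

variable {t : Fin k → ℝ} {p : Fin k → M} (ht : ∀ i, 0 ≤ t i) (hsum : ∑ i, t i = 1)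
include ht hsum

theorem le_weighted_sum {f : Fin k → ℝ} {m : ℝ} (h : ∀ i, m ≤ f i) : m ≤ ∑ i, t i * f i := by
  calc m = ∑ i, t i * m := by rw [← Finset.sum_mul, hsum, one_mul]
    _ ≤ _ := Finset.sum_le_sum fun i _ => mul_le_mul_of_nonneg_left (h i) (ht i)

theorem weighted_sum_le {f : Fin k → ℝ} {m : ℝ} (h : ∀ i, f i ≤ m) : ∑ i, t i * f i ≤ m := by
  calc _ ≤ ∑ i, t i * m := Finset.sum_le_sum fun i _ => mul_le_mul_of_nonneg_left (h i) (ht i)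
    _ = m := by rw [← Finset.sum_mul, hsum, one_mul]

/-- Weights summing to 1 force k ≥ 1. -/
theorem nonempty_of_sum_eq_one : Nonempty (Fin k) := by
  by_contra h
  rw [not_nonempty_iff] at h
  simp at hsum

theorem weighted_sum_pos {f : Fin k → ℝ} (h : ∀ i, 0 < f i) : 0 < ∑ i, t i * f i := by
  have := nonempty_of_sum_eq_one ht hsum
  obtain ⟨i, hi⟩ := Finite.exists_min f
  exact (h i).trans_le (le_weighted_sum ht hsum hi)

theorem exp_bubble (a : ℝ) (x : M) :
    Real.exp (bubble a t p x) = ∑ i, t i * (1 / (1 + a ^ 2 * dist x (p i) ^ 2)) ^ 2 :=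
  Real.exp_log (weighted_sum_pos ht hsum fun i => by positivity)

/-- Each summand grows by a factor at most exp(2e), hence so does the sum, whatever the weights. -/
theorem bubble_le_add {a e : ℝ} {x x' : M}
    (h : ∀ i, Real.log (1 + a ^ 2 * dist x (p i) ^ 2) ≤
      Real.log (1 + a ^ 2 * dist x' (p i) ^ 2) + e) :
    bubble a t p x' ≤ bubble a t p x + 2 * e := by
  rw [← Real.exp_le_exp, Real.exp_add, exp_bubble ht hsum, exp_bubble ht hsum, Finset.sum_mul]
  refine Finset.sum_le_sum fun i _ => ?_
  rw [mul_assoc]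
  refine mul_le_mul_of_nonneg_left ?_ (ht i)
  have key : ∀ z : M, (1 / (1 + a ^ 2 * dist z (p i) ^ 2)) ^ 2 =
      Real.exp (-(2 * Real.log (1 + a ^ 2 * dist z (p i) ^ 2))) := by
    intro z
    rw [Real.exp_neg, two_mul, Real.exp_add, Real.exp_log (by positivity)]
    field_simp
  rw [key, key, ← Real.exp_add]
  exact Real.exp_le_exp.2 (by linarith [h i])

theorem abs_bubble_sub_le {a e : ℝ} {x x' : M}
    (h : ∀ i, |Real.log (1 + a ^ 2 * dist x' (p i) ^ 2) -
      Real.log (1 + a ^ 2 * dist x (p i) ^ 2)| ≤ e) :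
    |bubble a t p x' - bubble a t p x| ≤ 2 * e := by
  rw [abs_sub_le_iff]
  constructor
  · have := bubble_le_add (x := x) (x' := x') ht hsum (a := a) (e := e) (p := p)
      fun i => by linarith [(abs_sub_le_iff.1 (h i)).2]
    linarith
  · have := bubble_le_add (x := x') (x' := x) ht hsum (a := a) (e := e) (p := p)
      fun i => by linarith [(abs_sub_le_iff.1 (h i)).1]
    linarith

theorem lipschitzWith_bubble {a : ℝ} (ha : 0 ≤ a) :
    LipschitzWith (2 * a).toNNReal (bubble a t p) := by
  refine LipschitzWith.of_dist_le_mul fun x x' => ?_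
  rw [Real.coe_toNNReal _ (by positivity), dist_comm, Real.dist_eq, mul_assoc]
  refine abs_bubble_sub_le ht hsum fun i => (abs_log_one_add_sq_sub_le ha _ _).trans ?_
  gcongr
  rw [dist_comm x x']
  exact abs_dist_sub_le x' x (p i)

/-- The local Lipschitz constant of a bubble is at most that of one of its profiles. -/
theorem exists_local_lipschitz_bubble (a : ℝ) (x : M) :
    ∃ i, ∀ ε > 0, ∀ᶠ x' in 𝓝 x, |bubble a t p x' - bubble a t p x| ≤
      (4 * a ^ 2 * dist x (p i) / (1 + a ^ 2 * dist x (p i) ^ 2) + ε) * dist x' x := by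
  have := nonempty_of_sum_eq_one ht hsum
  obtain ⟨i, hi⟩ := Finite.exists_max
    fun i => 4 * a ^ 2 * dist x (p i) / (1 + a ^ 2 * dist x (p i) ^ 2)
  refine ⟨i, fun ε hε => ?_⟩
  have h : ∀ j, ∀ᶠ x' in 𝓝 x, |Real.log (1 + a ^ 2 * dist x' (p j) ^ 2) -
      Real.log (1 + a ^ 2 * dist x (p j) ^ 2)| ≤
      (|2 * a ^ 2 * dist x (p j) / (1 + a ^ 2 * dist x (p j) ^ 2)| + ε / 2) *
        |dist x' (p j) - dist x (p j)| := by
    intro j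
    have hc : Tendsto (fun x' => dist x' (p j)) (𝓝 x) (𝓝 (dist x (p j))) :=
      Continuous.tendsto (by fun_prop) x
    exact hc.eventually (eventually_abs_log_one_add_sq_sub_le a _ (half_pos hε))
  filter_upwards [eventually_all.2 h] with x' hx'
  have := abs_bubble_sub_le ht hsum (x := x) (x' := x') (a := a) (p := p)
    (e := (2 * a ^ 2 * dist x (p i) / (1 + a ^ 2 * dist x (p i) ^ 2) + ε / 2) * dist x' x)
    fun j => by
      refine (hx' j).trans ?_
      have h1 : |2 * a ^ 2 * dist x (p j) / (1 + a ^ 2 * dist x (p j) ^ 2)| ≤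
          2 * a ^ 2 * dist x (p i) / (1 + a ^ 2 * dist x (p i) ^ 2) := by
        rw [abs_of_nonneg (by positivity)]
        have := hi j
        have e : ∀ j, 4 * a ^ 2 * dist x (p j) / (1 + a ^ 2 * dist x (p j) ^ 2) =
            2 * (2 * a ^ 2 * dist x (p j) / (1 + a ^ 2 * dist x (p j) ^ 2)) := fun j => by ring
        simp only [e] at this
        linarith
      gcongr
      exact abs_dist_sub_le x' x (p j)
  refine this.trans (le_of_eq ?_)
  ring

theorem bubble_nonpos (a : ℝ) (x : M) : bubble a t p x ≤ 0 := by
  rw [← Real.exp_le_exp, exp_bubble ht hsum, Real.exp_zero]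
  refine weighted_sum_le ht hsum fun i => ?_
  refine pow_le_one₀ (by positivity) ?_
  rw [div_le_one (by positivity)]
  exact le_add_of_nonneg_right (by positivity)

theorem bubble_le_of_le_dist {a δ : ℝ} (hδ : 0 ≤ δ) {x : M} (h : ∀ i, δ ≤ dist x (p i)) :
    bubble a t p x ≤ -2 * Real.log (1 + a ^ 2 * δ ^ 2) := by
  rw [← Real.exp_le_exp, exp_bubble ht hsum]
  refine weighted_sum_le ht hsum fun i => ?_
  rw [neg_mul, Real.exp_neg, two_mul, Real.exp_add, Real.exp_log (by positivity), div_pow, one_pow,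
    ← sq, one_div]
  gcongr
  exact h i

theorem le_bubble_of_dist_le {a D : ℝ} {x : M} (h : ∀ i, dist x (p i) ≤ D) :
    -2 * Real.log (1 + a ^ 2 * D ^ 2) ≤ bubble a t p x := by
  rw [← Real.exp_le_exp, exp_bubble ht hsum]
  refine le_weighted_sum ht hsum fun i => ?_
  rw [neg_mul, Real.exp_neg, two_mul, Real.exp_add, Real.exp_log (by positivity), div_pow, one_pow,
    ← sq, one_div]
  gcongr
  exact h i

/-- The square is taken out before Jensen's inequality is used. The sum of first powers has integral
O(log a / a²), which gives the sharp -4 log a; Jensen applied to the exponential of the bubble would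
give only -2 log a. -/
theorem bubble_le_log_sum (a : ℝ) (x : M) :
    bubble a t p x ≤ 2 * Real.log (∑ i, 1 / (1 + a ^ 2 * dist x (p i) ^ 2)) := by
  have := nonempty_of_sum_eq_one ht hsum
  have hpos : 0 < ∑ i, 1 / (1 + a ^ 2 * dist x (p i) ^ 2) :=
    Finset.sum_pos (fun i _ => by positivity) Finset.univ_nonempty
  rw [← Real.exp_le_exp, exp_bubble ht hsum, two_mul, Real.exp_add, Real.exp_log hpos, ← sq]
  refine weighted_sum_le ht hsum fun i => ?_
  gcongr
  exact Finset.single_le_sum (f := fun i => 1 / (1 + a ^ 2 * dist x (p i) ^ 2))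
    (fun i _ => by positivity) (Finset.mem_univ i)

omit ht in
theorem exists_one_div_le : ∃ i, 1 / (k : ℝ) ≤ t i := by
  by_contra! h
  have hk : Nonempty (Fin k) := by
    by_contra hk
    rw [not_nonempty_iff] at hk
    simp at hsum
  have := Finset.sum_lt_sum_of_nonempty Finset.univ_nonempty fun i _ => h i
  rw [hsum, Finset.sum_const, Finset.card_univ, Fintype.card_fin, nsmul_eq_mul] at this
  have hk0 : (k : ℝ) ≠ 0 := by
    have := Fin.pos_iff_nonempty.2 hk
    positivity
  rw [mul_one_div_cancel hk0] at this
  exact lt_irrefl _ this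

/-- Some weight is at least 1/k, and within distance 1/a of its centre the squared profile is at
least 1/4. -/
theorem exists_le_exp_bubble (a : ℝ) :
    ∃ i, ∀ x, dist x (p i) * max 1 a ≤ 1 → 0 ≤ a → 1 / (4 * k) ≤ Real.exp (bubble a t p x) := by
  obtain ⟨i, hi⟩ := exists_one_div_le hsum
  refine ⟨i, fun x hx ha => ?_⟩
  rw [exp_bubble ht hsum]
  have h1 : a * dist x (p i) ≤ 1 := by
    refine le_trans ?_ hx
    rw [mul_comm]
    gcongr
    exact le_max_right _ _
  have h2 : 1 / 4 ≤ (1 / (1 + a ^ 2 * dist x (p i) ^ 2)) ^ 2 := by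
    have : a ^ 2 * dist x (p i) ^ 2 ≤ 1 := by
      rw [← mul_pow]
      exact pow_le_one₀ (by positivity) h1
    calc (1 : ℝ) / 4 = (1 / (1 + 1)) ^ 2 := by norm_num
      _ ≤ _ := by gcongr
  calc 1 / (4 * (k : ℝ)) = 1 / k * (1 / 4) := by ring
    _ ≤ t i * (1 / (1 + a ^ 2 * dist x (p i) ^ 2)) ^ 2 := by
      gcongr
      exact ht i
    _ ≤ _ := Finset.single_le_sum (f := fun i => t i * (1 / (1 + a ^ 2 * dist x (p i) ^ 2)) ^ 2)
      (fun i _ => mul_nonneg (ht i) (by positivity)) (Finset.mem_univ i)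

end Bubble

/-! ### Integrals of bubbles and of their exponentials -/

section BubbleIntegrals

theorem log_one_add_sq_le {a D : ℝ} (ha : 0 ≤ a) :
    Real.log (1 + a ^ 2 * D ^ 2) ≤ 2 * Real.log (max 1 a) + Real.log (1 + D ^ 2) := by
  have h1 : 1 ≤ max 1 a := le_max_left _ _
  rw [← Real.log_rpow (by positivity), ← Real.log_mul (by positivity) (by positivity)]
  refine Real.log_le_log (by positivity) ?_
  have h2 : a ^ 2 ≤ max 1 a ^ 2 := by gcongr; exact le_max_right _ _
  have h3 : 1 ≤ max 1 a ^ 2 := one_le_pow₀ h1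
  norm_cast
  nlinarith [sq_nonneg D]

variable {M : Type*} [MetricSpace M] [CompactSpace M] [MeasurableSpace M] [BorelSpace M]
  {μ : Measure M} [IsProbabilityMeasure μ]

theorem integrable_of_continuous {f : M → ℝ} (hf : Continuous f) : Integrable f μ := by
  rw [← integrableOn_univ]
  exact hf.continuousOn.integrableOn_compact isCompact_univ

/-- If the measure of balls of radius `ρ < r` is at most `A ρ²`, the profile
`a² / (1 + a² d²)` has integral at most `2 A log a + O(1)`. -/
theorem integral_profile_le {r A : ℝ} (hr : 0 < r) (hr1 : r ≤ 1) (hA : 0 ≤ A) {x₀ : M}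
    (hball : ∀ ρ, 0 < ρ → ρ < r → μ.real (Metric.ball x₀ ρ) ≤ A * ρ ^ 2) {a : ℝ} (ha : 0 ≤ a) :
    ∫ x, a ^ 2 / (1 + a ^ 2 * dist x x₀ ^ 2) ∂μ ≤ 1 / r ^ 2 + 2 * A * Real.log (max 1 a) := by
  set F : M → ℝ := fun x => a ^ 2 / (1 + a ^ 2 * dist x x₀ ^ 2) with hF
  have hFc : Continuous F := by
    have : ∀ x : M, 1 + a ^ 2 * dist x x₀ ^ 2 ≠ 0 := fun x => by positivity
    fun_prop (disch := assumption)
  have hF0 : ∀ x, 0 ≤ F x := fun x => by positivity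
  have hFa : ∀ x, F x ≤ a ^ 2 := fun x => div_le_self (by positivity)
    (le_add_of_nonneg_right (by positivity))
  have hlog : 0 ≤ Real.log (max 1 a) := Real.log_nonneg (le_max_left _ _)
  rcases le_or_gt (a * r) 1 with har | har
  · calc ∫ x, F x ∂μ ≤ ∫ _, a ^ 2 ∂μ :=
          integral_mono (integrable_of_continuous hFc) (integrable_const _) hFa
      _ = a ^ 2 := by simp
      _ ≤ 1 / r ^ 2 := by
          rw [le_div_iff₀ (by positivity), ← mul_pow]
          exact pow_le_one₀ (by positivity) har
      _ ≤ _ := le_add_of_nonneg_right (by positivity)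
  have ha0 : 0 < a := by
    by_contra h
    have : a = 0 := le_antisymm (not_lt.1 h) ha
    simp [this] at har
    linarith
  have ha1 : 1 < a := by nlinarith
  -- Layer cake: below level s the measure is bounded by 1. Above it, {F ≥ τ} lies in the ball of
  -- radius τ^(-1/2) < r, of measure at most A/τ, which integrates to A log(a²r²).
  set s : ℝ := 1 / r ^ 2 with hs
  have hs0 : 0 < s := by positivity
  have hsa : s < a ^ 2 := by
    rw [hs, div_lt_iff₀ (by positivity), ← mul_pow]
    nlinarith
  set G : ℝ → ℝ := fun τ => μ.real {x | τ ≤ F x} with hG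
  have hanti : Antitone G := fun τ τ' h => measureReal_mono fun x (hx : τ' ≤ F x) => h.trans hx
  have hint : ∀ b c : ℝ, IntervalIntegrable G volume b c := fun b c =>
    (hanti.antitoneOn _).intervalIntegrable
  have hG1 : ∀ τ, G τ ≤ 1 := fun τ => measureReal_le_one
  have hGs : ∀ τ, s < τ → G τ ≤ A * (1 / τ) := by
    intro τ hτ
    have hτ0 : 0 < τ := hs0.trans hτ
    have hsq : Real.sqrt (1 / τ) < r := by
      rw [Real.sqrt_lt' hr, div_lt_comm₀ hτ0 (by positivity)]
      exact hτ
    have h := hball _ (Real.sqrt_pos.2 (by positivity)) hsq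
    rw [Real.sq_sqrt (by positivity)] at h
    refine le_trans (measureReal_mono fun x (hx : τ ≤ F x) => ?_) h
    rw [Metric.mem_ball]
    refine Real.lt_sqrt_of_sq_lt ?_
    rw [hF] at hx
    simp only at hx
    rw [le_div_iff₀ (by positivity)] at hx
    rw [lt_div_iff₀ hτ0]
    have ha2 : 0 < a ^ 2 := by positivity
    refine lt_of_mul_lt_mul_left (a := a ^ 2) ?_ ha2.le
    nlinarith
  calc ∫ x, F x ∂μ = ∫ τ in Ioc 0 (a ^ 2), G τ :=
        (integrable_of_continuous hFc).integral_eq_integral_Ioc_meas_le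
          (ae_of_all _ hF0) (ae_of_all _ hFa)
    _ = ∫ τ in (0 : ℝ)..a ^ 2, G τ := (intervalIntegral.integral_of_le (by positivity)).symm
    _ = (∫ τ in (0 : ℝ)..s, G τ) + ∫ τ in s..a ^ 2, G τ :=
        (intervalIntegral.integral_add_adjacent_intervals (hint _ _) (hint _ _)).symm
    _ ≤ (∫ _ in (0 : ℝ)..s, (1 : ℝ)) + ∫ τ in s..a ^ 2, A * (1 / τ) := by
        refine add_le_add ?_ ?_
        · exact intervalIntegral.integral_mono_on hs0.le (hint _ _) (by simp)
            fun τ _ => hG1 τ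
        · refine intervalIntegral.integral_mono_on_of_le_Ioo hsa.le (hint _ _) ?_
            fun τ hτ => hGs τ hτ.1
          refine ContinuousOn.intervalIntegrable ?_
          rw [uIcc_of_le hsa.le]
          refine ContinuousOn.mul continuousOn_const (ContinuousOn.div continuousOn_const
            continuousOn_id fun τ hτ => (hs0.trans_le hτ.1).ne')
    _ = s + A * Real.log (a ^ 2 * r ^ 2) := by
        rw [intervalIntegral.integral_const, intervalIntegral.integral_const_mul,
          integral_one_div_of_pos hs0 (by positivity)]
        simp [hs]
    _ ≤ s + A * (2 * Real.log (max 1 a)) := by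
        gcongr
        rw [max_eq_right ha1.le]
        calc Real.log (a ^ 2 * r ^ 2) ≤ Real.log (a ^ 2) := by
              refine Real.log_le_log (by positivity) ?_
              have : r ^ 2 ≤ 1 := pow_le_one₀ hr.le hr1
              nlinarith [sq_nonneg a]
          _ = 2 * Real.log a := by
              rw [Real.log_pow]
              norm_num
    _ = _ := by ring

/-- Jensen's inequality, from the tangent line bound log y ≤ y/m - 1 + log m. -/
theorem integral_log_le {Y : M → ℝ} (hY : Continuous Y) (hpos : ∀ x, 0 < Y x) {m : ℝ} (hm : 0 < m)
    (h : ∫ x, Y x ∂μ ≤ m) : ∫ x, Real.log (Y x) ∂μ ≤ Real.log m := by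
  have hc : Continuous fun x => Real.log (Y x) := hY.log fun x => (hpos x).ne'
  calc ∫ x, Real.log (Y x) ∂μ ≤ ∫ x, (Y x / m - 1 + Real.log m) ∂μ := by
        refine integral_mono (integrable_of_continuous hc)
          (integrable_of_continuous (by fun_prop)) fun x => ?_
        have h1 := Real.log_le_sub_one_of_pos (div_pos (hpos x) hm)
        rw [Real.log_div (hpos x).ne' hm.ne'] at h1
        linarith
    _ = (∫ x, Y x ∂μ) / m - 1 + Real.log m := by
        rw [integral_add (integrable_of_continuous (by fun_prop)) (integrable_const _),
          integral_sub (integrable_of_continuous (by fun_prop)) (integrable_const _),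
          integral_div]
        simp
    _ ≤ _ := by
        have : (∫ x, Y x ∂μ) / m ≤ 1 := (div_le_one hm).2 h
        linarith

variable {k : ℕ} {t : Fin k → ℝ} {p : Fin k → M} (ht : ∀ i, 0 ≤ t i) (hsum : ∑ i, t i = 1)
include ht hsum

theorem le_integral_bubble {D : ℝ} (hD : ∀ x y : M, dist x y ≤ D) {a : ℝ} (ha : 0 ≤ a) :
    -4 * Real.log (max 1 a) - 2 * Real.log (1 + D ^ 2) ≤ ∫ x, bubble a t p x ∂μ := by
  calc _ = ∫ _, (-4 * Real.log (max 1 a) - 2 * Real.log (1 + D ^ 2)) ∂μ := by simp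
    _ ≤ _ := by
      refine integral_mono (integrable_const _)
        (integrable_of_continuous (lipschitzWith_bubble ht hsum ha).continuous) fun x => ?_
      have h1 := le_bubble_of_dist_le ht hsum (a := a) (x := x) (p := p) fun i => hD x (p i)
      have h2 := log_one_add_sq_le (D := D) ha
      linarith

/-- For a > 1, Jensen applied to `bubble_le_log_sum`. The error beyond -4 log a is only the
logarithm of a logarithm. -/
theorem integral_bubble_le {r A : ℝ} (hr : 0 < r) (hr1 : r ≤ 1) (hA : 0 ≤ A)
    (hball : ∀ x₀ : M, ∀ ρ, 0 < ρ → ρ < r → μ.real (Metric.ball x₀ ρ) ≤ A * ρ ^ 2) {a : ℝ}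
    (ha : 0 ≤ a) :
    ∫ x, bubble a t p x ∂μ ≤ -4 * Real.log (max 1 a) +
      2 * Real.log (k * (1 / r ^ 2 + 2 * A * Real.log (max 1 a))) := by
  have hne := nonempty_of_sum_eq_one ht hsum
  have hk : 1 ≤ (k : ℝ) := by exact_mod_cast Fin.pos_iff_nonempty.2 hne
  have hlog : 0 ≤ Real.log (max 1 a) := Real.log_nonneg (le_max_left _ _)
  have hr2 : 1 ≤ 1 / r ^ 2 := by
    rw [le_div_iff₀ (by positivity), one_mul]
    exact pow_le_one₀ hr.le hr1
  have hbig : 1 ≤ k * (1 / r ^ 2 + 2 * A * Real.log (max 1 a)) := by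
    have : 1 ≤ 1 / r ^ 2 + 2 * A * Real.log (max 1 a) := by
      have : 0 ≤ 2 * A * Real.log (max 1 a) := by positivity
      linarith
    nlinarith
  rcases le_or_gt a 1 with ha1 | ha1
  · have h0 : ∫ x, bubble a t p x ∂μ ≤ 0 :=
      integral_nonpos fun x => bubble_nonpos ht hsum a x
    rw [max_eq_left ha1, Real.log_one] at hbig ⊢
    have := Real.log_nonneg hbig
    linarith
  have ha0 : 0 < a := by linarith
  rw [max_eq_right ha1.le] at hbig hlog ⊢
  set Y : M → ℝ := fun x => ∑ i, 1 / (1 + a ^ 2 * dist x (p i) ^ 2) with hY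
  have hprof : ∀ i, Continuous fun x : M => 1 / (1 + a ^ 2 * dist x (p i) ^ 2) := by
    intro i
    have : ∀ x : M, 1 + a ^ 2 * dist x (p i) ^ 2 ≠ 0 := fun x => by positivity
    fun_prop (disch := assumption)
  have hYc : Continuous Y := continuous_finsetSum _ fun i _ => hprof i
  have hY0 : ∀ x, 0 < Y x := fun x =>
    Finset.sum_pos (fun i _ => by positivity) Finset.univ_nonempty
  have hm : ∫ x, Y x ∂μ ≤ k * (1 / r ^ 2 + 2 * A * Real.log a) / a ^ 2 := by
    rw [hY, integral_finsetSum _ fun i _ => integrable_of_continuous (hprof i)]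
    calc ∑ i, ∫ x, 1 / (1 + a ^ 2 * dist x (p i) ^ 2) ∂μ
        ≤ ∑ _i : Fin k, (1 / r ^ 2 + 2 * A * Real.log a) / a ^ 2 := by
          refine Finset.sum_le_sum fun i _ => ?_
          rw [le_div_iff₀ (by positivity), ← integral_mul_const]
          have h := integral_profile_le hr hr1 hA (hball (p i)) ha
          rw [max_eq_right ha1.le] at h
          refine le_trans (le_of_eq ?_) h
          congr 1
          ext x
          ring
      _ = _ := by
          rw [Finset.sum_const, Finset.card_univ, Fintype.card_fin, nsmul_eq_mul]
          ring
  have hb0 : 0 < k * (1 / r ^ 2 + 2 * A * Real.log a) := by linarith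
  calc ∫ x, bubble a t p x ∂μ ≤ ∫ x, 2 * Real.log (Y x) ∂μ :=
        integral_mono (integrable_of_continuous (lipschitzWith_bubble ht hsum ha).continuous)
          (integrable_of_continuous (continuous_const.mul (hYc.log fun x => (hY0 x).ne')))
          fun x => bubble_le_log_sum ht hsum a x
    _ = 2 * ∫ x, Real.log (Y x) ∂μ := integral_const_mul _ _
    _ ≤ 2 * Real.log (k * (1 / r ^ 2 + 2 * A * Real.log a) / a ^ 2) := by
        gcongr
        exact integral_log_le hYc hY0 (by positivity) hm
    _ = _ := by
        rw [Real.log_div hb0.ne' (by positivity), Real.log_pow]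
        push_cast
        ring

/-- The mass of `h e^{v₁ - β v₂}` for bubbles `v₁`, `v₂` with distant centres. -/
theorem le_log_integral_exp_bubble {l : ℕ} {t' : Fin l → ℝ} {q : Fin l → M}
    (ht' : ∀ i, 0 ≤ t' i) (hsum' : ∑ i, t' i = 1)
    {r c δ m : ℝ} (hr : 0 < r) (hr1 : r ≤ 1) (hc : 0 < c)
    (hball : ∀ x₀ : M, ∀ ρ, 0 < ρ → ρ < r → c * ρ ^ 2 ≤ μ.real (Metric.ball x₀ ρ))
    (hδ : 0 < δ) (hpq : ∀ i j, δ ≤ dist (p i) (q j)) {h : M → ℝ} (hh : Continuous h)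
    (hm : 0 < m) (hhm : ∀ x, m ≤ h x) {a b β : ℝ} (ha : 0 ≤ a) (hb : 0 ≤ b) (hβ : 0 ≤ β) :
    -2 * Real.log (max 1 a) + 4 * β * Real.log (max 1 b) +
      (Real.log (m / (4 * k) * (c * (min (r / 2) (δ / 2)) ^ 2)) +
        2 * β * Real.log (min 1 (δ ^ 2 / 4))) ≤
      Real.log (∫ x, h x * Real.exp (bubble a t p x - β * bubble b t' q x) ∂μ) := by
  have hne := nonempty_of_sum_eq_one ht hsum
  have hk : 1 ≤ (k : ℝ) := by exact_mod_cast Fin.pos_iff_nonempty.2 hne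
  have hma : 1 ≤ max 1 a := le_max_left _ _
  have hmb : 1 ≤ max 1 b := le_max_left _ _
  obtain ⟨i, hi⟩ := exists_le_exp_bubble (p := p) ht hsum a
  set r' := min (r / 2) (δ / 2) with hr'
  have hr'0 : 0 < r' := by positivity
  have hr'r : r' ≤ r / 2 := min_le_left _ _
  have hr'δ : r' ≤ δ / 2 := min_le_right _ _
  -- On this ball around a heavy centre, e^{v₁} is bounded below, and the area, of order max(1,a)⁻²,
  -- yields the term -2 log max(1,a). Since r' ≤ δ/2, the ball stays δ/2 away from every `q j`,
  -- where -βv₂ is at least 4β log max(1,b) up to a constant.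
  set ρ := r' / max 1 a with hρ
  have hρ0 : 0 < ρ := by positivity
  have hρr : ρ ≤ r' := div_le_self hr'0.le hma
  -- Chosen so that e · max(1,b)² ≤ 1 + b²δ²/4 whether or not b exceeds 1.
  set e := min 1 (δ ^ 2 / 4) with he
  have he0 : 0 < e := by positivity
  have hbc := (lipschitzWith_bubble (p := p) ht hsum ha).continuous
  have hbc' := (lipschitzWith_bubble (p := q) ht' hsum' hb).continuous
  have hcont : Continuous fun x => h x * Real.exp (bubble a t p x - β * bubble b t' q x) := by
    fun_prop
  have hlow : ∀ x ∈ Metric.ball (p i) ρ,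
      m / (4 * k) * Real.exp (2 * β * (2 * Real.log (max 1 b) + Real.log e)) ≤
        h x * Real.exp (bubble a t p x - β * bubble b t' q x) := by
    intro x hx
    rw [Metric.mem_ball] at hx
    have h1 := hi x (by
      calc dist x (p i) * max 1 a ≤ ρ * max 1 a := by gcongr
        _ = r' := by rw [hρ]; field_simp
        _ ≤ 1 := by linarith) ha
    have h2 : bubble b t' q x ≤ -2 * Real.log (1 + b ^ 2 * (δ / 2) ^ 2) := by
      refine bubble_le_of_le_dist ht' hsum' (by positivity) fun j => ?_
      have := dist_triangle_left (p i) (q j) x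
      linarith [hpq i j]
    have h3 : 2 * Real.log (max 1 b) + Real.log e ≤ Real.log (1 + b ^ 2 * (δ / 2) ^ 2) := by
      rw [← Real.log_rpow (by positivity), ← Real.log_mul (by positivity) (by positivity)]
      refine Real.log_le_log (by positivity) ?_
      have e1 : e ≤ 1 := min_le_left _ _
      have e2 : e ≤ δ ^ 2 / 4 := min_le_right _ _
      norm_cast
      rcases le_total b 1 with hb1 | hb1
      · rw [max_eq_left hb1]
        nlinarith [mul_nonneg (sq_nonneg b) (sq_nonneg (δ / 2))]
      · rw [max_eq_right hb1]
        nlinarith [mul_le_mul_of_nonneg_left e2 (sq_nonneg b)]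
    rw [sub_eq_add_neg, Real.exp_add, ← mul_assoc]
    have h4 : 2 * β * (2 * Real.log (max 1 b) + Real.log e) ≤ -(β * bubble b t' q x) := by
      nlinarith
    calc m / (4 * k) * Real.exp (2 * β * (2 * Real.log (max 1 b) + Real.log e))
        = m * (1 / (4 * k)) * Real.exp (2 * β * (2 * Real.log (max 1 b) + Real.log e)) := by ring
      _ ≤ h x * Real.exp (bubble a t p x) * Real.exp (-(β * bubble b t' q x)) := by
        have := hm.le.trans (hhm x)
        gcongr
        exact hhm x
  have hfinal : m / (4 * k) * Real.exp (2 * β * (2 * Real.log (max 1 b) + Real.log e)) *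
      (c * ρ ^ 2) ≤ ∫ x, h x * Real.exp (bubble a t p x - β * bubble b t' q x) ∂μ := by
    calc _ ≤ m / (4 * k) * Real.exp (2 * β * (2 * Real.log (max 1 b) + Real.log e)) *
          μ.real (Metric.ball (p i) ρ) := by
          gcongr
          exact hball _ _ hρ0 (by linarith)
      _ ≤ ∫ x in Metric.ball (p i) ρ,
          h x * Real.exp (bubble a t p x - β * bubble b t' q x) ∂μ :=
          setIntegral_ge_of_const_le_real measurableSet_ball (measure_ne_top _ _) hlow
            (integrable_of_continuous hcont).integrableOn
      _ ≤ _ := setIntegral_le_integral (integrable_of_continuous hcont)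
          (ae_of_all _ fun x => mul_nonneg (hm.le.trans (hhm x)) (Real.exp_pos _).le)
  refine le_trans (le_of_eq ?_) (Real.log_le_log (by positivity) hfinal)
  have e1 : Real.log (m / (4 * k) * Real.exp (2 * β * (2 * Real.log (max 1 b) + Real.log e)) *
      (c * ρ ^ 2)) = Real.log (m / (4 * k)) + 2 * β * (2 * Real.log (max 1 b) + Real.log e) +
        (Real.log c + (2 * Real.log r' - 2 * Real.log (max 1 a))) := by
    rw [Real.log_mul (by positivity) (by positivity), Real.log_mul (by positivity)
      (by positivity), Real.log_exp, Real.log_mul hc.ne' (by positivity), Real.log_pow, hρ,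
      Real.log_div hr'0.ne' (by positivity : max 1 a ≠ 0)]
    push_cast
    ring
  have e2 : Real.log (m / (4 * k) * (c * r' ^ 2)) =
      Real.log (m / (4 * k)) + (Real.log c + 2 * Real.log r') := by
    rw [Real.log_mul (by positivity) (by positivity), Real.log_mul hc.ne' (by positivity),
      Real.log_pow]
    push_cast
    ring
  rw [e1, e2]
  ring

end BubbleIntegrals

/-! ### Bubbles with separated centres -/

section SeparatedBubbles

theorem slope_mul_le {a d : ℝ} : 4 * a ^ 2 * d / (1 + a ^ 2 * d ^ 2) * d ≤ 4 := by
  rw [div_mul_eq_mul_div, div_le_iff₀ (by positivity)]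
  nlinarith

theorem slope_sq_le {a d : ℝ} :
    (4 * a ^ 2 * d / (1 + a ^ 2 * d ^ 2)) ^ 2 ≤ 16 * (a ^ 2 / (1 + a ^ 2 * d ^ 2)) := by
  have h : 0 < 1 + a ^ 2 * d ^ 2 := by positivity
  rw [div_pow, ← mul_div_assoc, div_le_div_iff₀ (by positivity) h]
  have : 0 ≤ 16 * a ^ 2 * (1 + a ^ 2 * d ^ 2) := by positivity
  nlinarith

/-- The slope is at most 4/d whatever a is, so away from the centre it is bounded uniformly in a. -/
theorem slope_le_of_le {a d δ : ℝ} (hδ : 0 < δ) (hd : δ / 2 ≤ d) :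
    4 * a ^ 2 * d / (1 + a ^ 2 * d ^ 2) ≤ 8 / δ := by
  have h0 : 0 ≤ 4 * a ^ 2 * d / (1 + a ^ 2 * d ^ 2) := by
    have : 0 ≤ d := by linarith
    positivity
  have h1 := slope_mul_le (a := a) (d := d)
  rw [le_div_iff₀ hδ]
  nlinarith

/-- Young's inequality for the mixed term AB: the factor bounded by K goes into K²/η and the other
is absorbed with weight η. -/
theorem sq_add_half_le {A B K η : ℝ} (hA : 0 ≤ A) (hB : 0 ≤ B) (hη : 0 < η)
    (h : A ≤ K ∨ B ≤ K) :
    (A + 1 / 2 * B) ^ 2 ≤ (1 + η) * (A ^ 2 + B ^ 2 / 4) + K ^ 2 / η := by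
  have hs : (A + 1 / 2 * B) ^ 2 = A ^ 2 + B ^ 2 / 4 + A * B := by ring
  have key : A * B ≤ η * (A ^ 2 + B ^ 2 / 4) + K ^ 2 / η := by
    have hK : K ^ 2 / η * η = K ^ 2 := div_mul_cancel₀ _ hη.ne'
    refine le_of_mul_le_mul_right ?_ hη
    rw [add_mul, hK]
    rcases h with h | h
    · have : A ^ 2 ≤ K ^ 2 := by gcongr
      nlinarith [sq_nonneg (A - η * B / 2), sq_nonneg (η * A)]
    · have : B ^ 2 ≤ K ^ 2 := by gcongr
      nlinarith [sq_nonneg (η * A - B / 2), sq_nonneg (η * B)]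
  linarith

variable {M : Type*} [MetricSpace M] {k l : ℕ} {t : Fin k → ℝ} {p : Fin k → M}
  {t' : Fin l → ℝ} {q : Fin l → M}

/-- The difference of two bubbles with separated centres: the mixed term in the square of the
slope is negligible. -/
theorem exists_local_lipschitz_bubble_sub (ht : ∀ i, 0 ≤ t i) (hsum : ∑ i, t i = 1)
    (ht' : ∀ i, 0 ≤ t' i) (hsum' : ∑ i, t' i = 1) {δ η : ℝ} (hδ : 0 < δ) (hη : 0 < η)
    (hpq : ∀ i j, δ ≤ dist (p i) (q j)) (a b : ℝ) (x : M) :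
    ∃ C, 0 ≤ C ∧ C ^ 2 ≤ (1 + η) * (16 * (∑ i, a ^ 2 / (1 + a ^ 2 * dist x (p i) ^ 2)) +
        4 * ∑ j, b ^ 2 / (1 + b ^ 2 * dist x (q j) ^ 2)) + (8 / δ) ^ 2 / η ∧
      ∀ ε > 0, ∀ᶠ x' in 𝓝 x, |(bubble a t p x' - 1 / 2 * bubble b t' q x') -
        (bubble a t p x - 1 / 2 * bubble b t' q x)| ≤ (C + ε) * dist x' x := by
  obtain ⟨i, hi⟩ := exists_local_lipschitz_bubble (p := p) ht hsum a x
  obtain ⟨j, hj⟩ := exists_local_lipschitz_bubble (p := q) ht' hsum' b x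
  set A := 4 * a ^ 2 * dist x (p i) / (1 + a ^ 2 * dist x (p i) ^ 2) with hA
  set B := 4 * b ^ 2 * dist x (q j) / (1 + b ^ 2 * dist x (q j) ^ 2) with hB
  have hA0 : 0 ≤ A := by positivity
  have hB0 : 0 ≤ B := by positivity
  refine ⟨A + 1 / 2 * B, by positivity, ?_, fun ε hε => ?_⟩
  · have hor : A ≤ 8 / δ ∨ B ≤ 8 / δ := by
      have h1 := dist_triangle_left (p i) (q j) x
      have h2 := hpq i j
      rcases le_total (δ / 2) (dist x (p i)) with h | h
      · exact Or.inl (slope_le_of_le hδ h)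
      · exact Or.inr (slope_le_of_le hδ (by linarith))
    refine (sq_add_half_le hA0 hB0 hη hor).trans ?_
    have hAs : A ^ 2 ≤ 16 * ∑ i, a ^ 2 / (1 + a ^ 2 * dist x (p i) ^ 2) := by
      refine slope_sq_le.trans ?_
      gcongr
      exact Finset.single_le_sum (f := fun i => a ^ 2 / (1 + a ^ 2 * dist x (p i) ^ 2))
        (fun i _ => by positivity) (Finset.mem_univ i)
    have hBs : B ^ 2 ≤ 16 * ∑ j, b ^ 2 / (1 + b ^ 2 * dist x (q j) ^ 2) := by
      refine slope_sq_le.trans ?_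
      gcongr
      exact Finset.single_le_sum (f := fun j => b ^ 2 / (1 + b ^ 2 * dist x (q j) ^ 2))
        (fun i _ => by positivity) (Finset.mem_univ j)
    gcongr ?_ + _
    gcongr
    linarith
  · filter_upwards [hi (ε / 2) (by positivity), hj ε hε] with x' h1 h2
    rw [abs_le] at h1 h2 ⊢
    constructor <;> nlinarith [h1.1, h1.2, h2.1, h2.2]

variable [CompactSpace M] [MeasurableSpace M] [BorelSpace M]

/-- The lower bound comes from the diameter. In the upper bound the log-log error is absorbed into η
log max(1,a) by log(θX) ≤ θX - 1. -/
theorem exists_abs_integral_bubble_add_le {μ : Measure M} [IsProbabilityMeasure μ] (k : ℕ)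
    {r A η : ℝ} (hr : 0 < r) (hr1 : r ≤ 1) (hA : 0 ≤ A) (hη : 0 < η)
    (hball : ∀ x₀ : M, ∀ ρ, 0 < ρ → ρ < r → μ.real (Metric.ball x₀ ρ) ≤ A * ρ ^ 2) :
    ∃ C, ∀ (t : Fin k → ℝ) (p : Fin k → M) (a : ℝ), (∀ i, 0 ≤ t i) → ∑ i, t i = 1 → 0 ≤ a →
      |∫ x, bubble a t p x ∂μ + 4 * Real.log (max 1 a)| ≤ η * Real.log (max 1 a) + C := by
  obtain ⟨D, hD⟩ := (Metric.isBounded_iff.1 (isCompact_univ (X := M)).isBounded)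
  -- The absorbed term has coefficient 2 · θ · k · 2A = 4kAθ, which must not exceed η; the +1 keeps
  -- the denominator positive.
  set θ := η / (4 * k * A + 1) with hθ
  have hθ0 : 0 < θ := by positivity
  have hθη : 4 * k * A * θ ≤ η := by
    have : θ * (4 * k * A + 1) = η := div_mul_cancel₀ _ (by positivity)
    nlinarith
  refine ⟨max (2 * Real.log (1 + D ^ 2)) (2 * (θ * (k * (1 / r ^ 2)) - Real.log θ)),
    fun t p a ht hsum ha => ?_⟩
  have hlog : 0 ≤ Real.log (max 1 a) := Real.log_nonneg (le_max_left _ _)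
  have h1 := le_integral_bubble (μ := μ) (p := p) ht hsum
    (fun x y => hD (mem_univ x) (mem_univ y)) ha
  have h2 := integral_bubble_le (μ := μ) (p := p) ht hsum hr hr1 hA hball ha
  have hne := nonempty_of_sum_eq_one ht hsum
  have hk : 1 ≤ (k : ℝ) := by exact_mod_cast Fin.pos_iff_nonempty.2 hne
  have h3 := Real.log_le_sub_one_of_pos
    (show 0 < θ * (k * (1 / r ^ 2 + 2 * A * Real.log (max 1 a))) by positivity)
  rw [Real.log_mul hθ0.ne' (by positivity)] at h3
  have h4 := le_max_left (2 * Real.log (1 + D ^ 2)) (2 * (θ * (k * (1 / r ^ 2)) - Real.log θ))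
  have h5 := le_max_right (2 * Real.log (1 + D ^ 2)) (2 * (θ * (k * (1 / r ^ 2)) - Real.log θ))
  have h6 : 4 * k * A * θ * Real.log (max 1 a) ≤ η * Real.log (max 1 a) := by gcongr
  have h7 : 0 ≤ η * Real.log (max 1 a) := by positivity
  rw [abs_le]
  constructor <;> linarith

end SeparatedBubbles

/-! ### The energy of a difference of bubbles -/

section EnergyOfBubbles

variable {M : Type*} [MetricSpace M] [ChartedSpace Plane M]
  [RiemannianBundle (fun x : M => TangentSpace (𝓡 2) x)]
  [IsManifold (𝓡 2) ∞ M] [IsContinuousRiemannianBundle Plane (fun x : M => TangentSpace (𝓡 2) x)]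
  [IsRiemannianManifold (𝓡 2) M] [MeasurableSpace M] [BorelSpace M] [CompactSpace M]

theorem exists_lipschitzWith_bubble_sub {k l : ℕ} {t : Fin k → ℝ} {p : Fin k → M}
    {t' : Fin l → ℝ} {q : Fin l → M} (ht : ∀ i, 0 ≤ t i) (hsum : ∑ i, t i = 1)
    (ht' : ∀ i, 0 ≤ t' i) (hsum' : ∑ i, t' i = 1) {a b : ℝ} (ha : 0 ≤ a) (hb : 0 ≤ b) :
    ∃ K, LipschitzWith K fun x => bubble a t p x - 1 / 2 * bubble b t' q x :=
  ⟨_, (lipschitzWith_bubble ht hsum ha).sub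
    ((lipschitzWith_smul (1 / 2 : ℝ)).comp (lipschitzWith_bubble ht' hsum' hb))⟩

variable [IsProbabilityMeasure (riemannianVolume M)]

/-- Each profile integrates to 2A log max(1,·) + O(1). The squared slopes carry the factors 16 and
16/4, whence 32k and 8l. -/
theorem exists_integral_norm_weakGradient_bubble_sub_le (k l : ℕ) {δ η r A : ℝ} (hδ : 0 < δ)
    (hη : 0 < η) (hr : 0 < r) (hr1 : r ≤ 1) (hA : 0 ≤ A)
    (hball : ∀ x₀ : M, ∀ ρ, 0 < ρ → ρ < r →
      (riemannianVolume M).real (Metric.ball x₀ ρ) ≤ A * ρ ^ 2) :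
    ∃ C, ∀ (t : Fin k → ℝ) (p : Fin k → M) (t' : Fin l → ℝ) (q : Fin l → M) (a b : ℝ),
      (∀ i, 0 ≤ t i) → ∑ i, t i = 1 → (∀ i, 0 ≤ t' i) → ∑ i, t' i = 1 →
      (∀ i j, δ ≤ dist (p i) (q j)) → 0 ≤ a → 0 ≤ b →
      ∫ x, ‖weakGradient (fun x => bubble a t p x - 1 / 2 * bubble b t' q x) x‖ ^ 2
          ∂(riemannianVolume M) ≤
        (1 + η) * A * (32 * k * Real.log (max 1 a) + 8 * l * Real.log (max 1 b)) + C := by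
  refine ⟨(1 + η) * ((16 * k + 4 * l) * (1 / r ^ 2)) + (8 / δ) ^ 2 / η,
    fun t p t' q a b ht hsum ht' hsum' hpq ha hb => ?_⟩
  obtain ⟨K, hK⟩ := exists_lipschitzWith_bubble_sub (p := p) (q := q) ht hsum ht' hsum' ha hb
  have hprof : ∀ (a : ℝ) (z : M), Continuous fun x : M => a ^ 2 / (1 + a ^ 2 * dist x z ^ 2) := by
    intro a z
    have : ∀ x : M, 1 + a ^ 2 * dist x z ^ 2 ≠ 0 := fun x => by positivity
    fun_prop (disch := assumption)
  have hsumc : ∀ (n : ℕ) (a : ℝ) (z : Fin n → M),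
      Continuous fun x : M => ∑ i, a ^ 2 / (1 + a ^ 2 * dist x (z i) ^ 2) := fun n a z =>
    continuous_finsetSum _ fun i _ => hprof a (z i)
  have hint : ∀ (n : ℕ) (a : ℝ) (z : Fin n → M), 0 ≤ a →
      ∫ x, ∑ i, a ^ 2 / (1 + a ^ 2 * dist x (z i) ^ 2) ∂(riemannianVolume M) ≤
        n * (1 / r ^ 2 + 2 * A * Real.log (max 1 a)) := by
    intro n a z ha
    rw [integral_finsetSum _ fun i _ => integrable_of_continuous (hprof a (z i))]
    calc _ ≤ ∑ _i : Fin n, (1 / r ^ 2 + 2 * A * Real.log (max 1 a)) :=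
          Finset.sum_le_sum fun i _ => integral_profile_le hr hr1 hA (hball (z i)) ha
      _ = _ := by rw [Finset.sum_const, Finset.card_univ, Fintype.card_fin, nsmul_eq_mul]
  have hc1 := hsumc k a p
  have hc2 := hsumc l b q
  refine (integral_norm_weakGradient_sq_le hK (integrable_of_continuous (by fun_prop))
    (exists_local_lipschitz_bubble_sub ht hsum ht' hsum' hδ hη hpq a b)).trans ?_
  rw [integral_add (integrable_of_continuous (by fun_prop)) (integrable_const _),
    integral_const_mul, integral_add (integrable_of_continuous (by fun_prop))
      (integrable_of_continuous (by fun_prop)), integral_const_mul, integral_const_mul]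
  have h1 := hint k a p ha
  have h2 := hint l b q hb
  have hη1 : 0 ≤ 1 + η := by linarith
  have h3 : (1 + η) * (16 * ∫ x, ∑ i, a ^ 2 / (1 + a ^ 2 * dist x (p i) ^ 2)
      ∂(riemannianVolume M) + 4 * ∫ x, ∑ i, b ^ 2 / (1 + b ^ 2 * dist x (q i) ^ 2)
      ∂(riemannianVolume M)) ≤ (1 + η) * (16 * (k * (1 / r ^ 2 + 2 * A * Real.log (max 1 a))) +
        4 * (l * (1 / r ^ 2 + 2 * A * Real.log (max 1 b)))) := by gcongr
  simp only [integral_const, probReal_univ, smul_eq_mul, one_mul]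
  linarith

theorem exists_energy_bubble_sub_le (k l : ℕ) {δ η ρ₁ ρ₂ m : ℝ} (hδ : 0 < δ) (hη : 0 < η)
    (hρ₁ : 0 ≤ ρ₁) (hρ₂ : 0 ≤ ρ₂) {h₁ h₂ : M → ℝ} (hh₁ : Continuous h₁) (hh₂ : Continuous h₂)
    (hm : 0 < m) (hm₁ : ∀ x, m ≤ h₁ x) (hm₂ : ∀ x, m ≤ h₂ x) :
    ∃ C, ∀ (t : Fin k → ℝ) (p : Fin k → M) (t' : Fin l → ℝ) (q : Fin l → M) (a b : ℝ),
      (∀ i, 0 ≤ t i) → ∑ i, t i = 1 → (∀ i, 0 ≤ t' i) → ∑ i, t' i = 1 →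
      (∀ i j, δ ≤ dist (p i) (q j)) → 0 ≤ a → 0 ≤ b →
      energy h₁ h₂ ρ₁ ρ₂ (fun x => bubble a t p x - 1 / 2 * bubble b t' q x) ≤
        ((1 + η) ^ 4 * (16 * k * Real.pi) - 2 * ρ₁ + |ρ₁ - ρ₂| * η) * Real.log (max 1 a) +
        ((1 + η) ^ 4 * (4 * l * Real.pi) - ρ₂ + |ρ₁ - ρ₂| * η) * Real.log (max 1 b) + C := by
  -- Areas lose (1+η)³ and Young's inequality one more factor: hence the fourth power.
  obtain ⟨r₀, hr₀, hvol⟩ := exists_volume_ball_bounds (M := M) (κ := 1 + η) (by linarith)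
  set r := min r₀ 1 with hr
  have hr0 : 0 < r := by positivity
  have hr1 : r ≤ 1 := min_le_right _ _
  set A := (1 + η) ^ 3 * Real.pi with hA
  set c := ((1 + η) ^ 3)⁻¹ * Real.pi with hc
  have hA0 : 0 ≤ A := by positivity
  have hc0 : 0 < c := by positivity
  have hup : ∀ x₀ : M, ∀ ρ, 0 < ρ → ρ < r →
      (riemannianVolume M).real (Metric.ball x₀ ρ) ≤ A * ρ ^ 2 := by
    intro x₀ ρ h0 h1
    refine (ENNReal.toReal_le_of_le_ofReal (by positivity)
      (hvol x₀ ρ h0 (h1.trans_le (min_le_left _ _))).1).trans (le_of_eq (by rw [hA]; ring))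
  have hlow : ∀ x₀ : M, ∀ ρ, 0 < ρ → ρ < r →
      c * ρ ^ 2 ≤ (riemannianVolume M).real (Metric.ball x₀ ρ) := by
    intro x₀ ρ h0 h1
    refine le_trans (le_of_eq (by rw [hc]; ring))
      ((ENNReal.ofReal_le_iff_le_toReal (measure_ne_top _ _)).1
        (hvol x₀ ρ h0 (h1.trans_le (min_le_left _ _))).2)
  obtain ⟨C₀, hgrad⟩ := exists_integral_norm_weakGradient_bubble_sub_le k l hδ hη hr0 hr1 hA0 hup
  obtain ⟨C₁, hmean₁⟩ := exists_abs_integral_bubble_add_le k hr0 hr1 hA0 hη hup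
  obtain ⟨C₂, hmean₂⟩ := exists_abs_integral_bubble_add_le l hr0 hr1 hA0 hη hup
  set E : ℕ → ℝ → ℝ := fun n β => Real.log (m / (4 * n) * (c * (min (r / 2) (δ / 2)) ^ 2)) +
    2 * β * Real.log (min 1 (δ ^ 2 / 4)) with hE
  refine ⟨C₀ / 2 - ρ₁ * E k (1 / 2) - ρ₂ / 2 * E l 2 + |ρ₁ - ρ₂| * (C₁ + C₂ / 2),
    fun t p t' q a b ht hsum ht' hsum' hpq ha hb => ?_⟩
  have h0 := hgrad t p t' q a b ht hsum ht' hsum' hpq ha hb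
  have h1 := hmean₁ t p a ht hsum ha
  have h2 := hmean₂ t' q b ht' hsum' hb
  have h3 := le_log_integral_exp_bubble (μ := riemannianVolume M) ht hsum ht' hsum' hr0 hr1 hc0
    hlow hδ hpq hh₁ hm hm₁ ha hb (show (0 : ℝ) ≤ 1 / 2 by norm_num)
  -- The roles are exchanged: -2φ is the second bubble minus twice the first, so β = 2 replaces β =
  -- 1/2.
  have h4 := le_log_integral_exp_bubble (μ := riemannianVolume M) ht' hsum' ht hsum hr0 hr1 hc0
    hlow hδ (fun i j => (hpq j i).trans_eq (dist_comm _ _)) hh₂ hm hm₂ hb ha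
    (show (0 : ℝ) ≤ 2 by norm_num)
  have hbc := (lipschitzWith_bubble (p := p) ht hsum ha).continuous
  have hbc' := (lipschitzWith_bubble (p := q) ht' hsum' hb).continuous
  have hexp : ∀ x, -2 * (bubble a t p x - 1 / 2 * bubble b t' q x) =
      bubble b t' q x - 2 * bubble a t p x := fun x => by ring
  have hI : ∫ x, (bubble a t p x - 1 / 2 * bubble b t' q x) ∂(riemannianVolume M) =
      ∫ x, bubble a t p x ∂(riemannianVolume M) -
        1 / 2 * ∫ x, bubble b t' q x ∂(riemannianVolume M) := by
    rw [integral_sub (integrable_of_continuous hbc)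
      (integrable_of_continuous (by fun_prop)), integral_const_mul]
  unfold energy
  simp only [hexp]
  rw [integral_const_mul, hI]
  set ℓ₁ := Real.log (max 1 a)
  set ℓ₂ := Real.log (max 1 b)
  set I₁ := ∫ x, bubble a t p x ∂(riemannianVolume M)
  set I₂ := ∫ x, bubble b t' q x ∂(riemannianVolume M)
  set N₁ := Real.log (∫ x, h₁ x * Real.exp (bubble a t p x - 1 / 2 * bubble b t' q x)
    ∂(riemannianVolume M))
  set N₂ := Real.log (∫ x, h₂ x * Real.exp (bubble b t' q x - 2 * bubble a t p x)
    ∂(riemannianVolume M))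
  have hℓ₂ : 0 ≤ ℓ₂ := Real.log_nonneg (le_max_left _ _)
  have h5 : ρ₁ * (-2 * ℓ₁ + 4 * (1 / 2) * ℓ₂ + E k (1 / 2)) ≤ ρ₁ * N₁ := by gcongr
  have h6 : ρ₂ / 2 * (-2 * ℓ₂ + 4 * 2 * ℓ₁ + E l 2) ≤ ρ₂ / 2 * N₂ := by gcongr
  have h7 : (ρ₁ - ρ₂) * ((I₁ + 4 * ℓ₁) - 1 / 2 * (I₂ + 4 * ℓ₂)) ≤
      |ρ₁ - ρ₂| * (η * ℓ₁ + C₁ + 1 / 2 * (η * ℓ₂ + C₂)) := by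
    refine (le_abs_self _).trans ?_
    rw [abs_mul]
    gcongr
    rw [abs_le] at h1 h2 ⊢
    constructor <;> linarith [h1.1, h1.2, h2.1, h2.2]
  -- The second mean enters with the factor 1/2, while the stated coefficient allows the full η.
  have h8 : 0 ≤ |ρ₁ - ρ₂| * η * ℓ₂ := by positivity
  have h9 : (1 + η) * A * (32 * k * ℓ₁ + 8 * l * ℓ₂) =
      2 * ((1 + η) ^ 4 * (16 * k * Real.pi) * ℓ₁ + (1 + η) ^ 4 * (4 * l * Real.pi) * ℓ₂) := by
    rw [hA]
    ring
  linarith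

end EnergyOfBubbles

/-! ### Representatives in the join, separation of the curves, and the conclusion -/

section Join

variable {M : Type*} [MetricSpace M] [MeasurableSpace M] [BorelSpace M]

theorem exists_testFunction_eq {S T : Set M} {k l : ℕ} (lam : ℝ)
    (ζ : Join (formalBarycentres S k) (formalBarycentres T l)) :
    ∃ (t : Fin k → ℝ) (p : Fin k → M) (t' : Fin l → ℝ) (q : Fin l → M) (s : ℝ),
      (∀ i, 0 ≤ t i) ∧ ∑ i, t i = 1 ∧ (∀ i, p i ∈ S) ∧
      (∀ i, 0 ≤ t' i) ∧ ∑ i, t' i = 1 ∧ (∀ i, q i ∈ T) ∧ 0 ≤ s ∧ s ≤ 1 ∧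
      testFunction lam ζ =
        fun x => bubble ((1 - s) * lam) t p x - 1 / 2 * bubble (s * lam) t' q x := by
  induction ζ using Quot.ind with
  | mk ζ =>
  obtain ⟨⟨_, t, p, ht, hsum, hp, rfl⟩, ⟨_, t', q, ht', hsum', hq, rfl⟩, s⟩ := ζ
  refine ⟨t, p, t', q, s, ht, hsum, hp, ht', hsum', hq, s.2.1, s.2.2, ?_⟩
  funext x
  change logBubble _ _ x - 1 / 2 * logBubble _ _ x = _
  rw [logBubble_eq _ _ _ ht, logBubble_eq _ _ _ ht']
  rfl

end Join

theorem exists_pos_le_dist_of_disjoint {M X Y : Type*} [MetricSpace M] [TopologicalSpace X]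
    [TopologicalSpace Y] [CompactSpace X] [CompactSpace Y] {γ₁ : X → M} {γ₂ : Y → M}
    (hγ₁ : Continuous γ₁) (hγ₂ : Continuous γ₂) (hdisj : Disjoint (range γ₁) (range γ₂)) :
    ∃ δ > 0, ∀ x ∈ range γ₁, ∀ y ∈ range γ₂, δ ≤ dist x y := by
  obtain ⟨δ, hδ, h⟩ := Metric.exists_pos_forall_lt_edist (isCompact_range hγ₁)
    (isCompact_range hγ₂).isClosed hdisj
  refine ⟨δ, hδ, fun x hx y hy => ?_⟩
  have := (h x hx y hy).le
  rwa [edist_nndist, ENNReal.coe_le_coe] at this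

theorem exists_pos_le_of_continuous {M : Type*} [TopologicalSpace M] [CompactSpace M]
    {h : M → ℝ} (hc : Continuous h) (hpos : ∀ x, 0 < h x) : ∃ m > 0, ∀ x, m ≤ h x := by
  obtain ⟨m, hm, h⟩ := isCompact_univ.exists_forall_le' hc.continuousOn fun x _ => hpos x
  exact ⟨m, hm, fun x => h x (mem_univ x)⟩

/-- One of s, 1-s is at least 1/2, so one of the two parameters is at least λ/2. This is the source
of uniformity in s. -/
theorem log_half_le_add_log_max {lam s : ℝ} (hlam : 0 < lam) :
    Real.log (lam / 2) ≤ Real.log (max 1 ((1 - s) * lam)) + Real.log (max 1 (s * lam)) := by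
  have h1 : 0 ≤ Real.log (max 1 ((1 - s) * lam)) := Real.log_nonneg (le_max_left _ _)
  have h2 : 0 ≤ Real.log (max 1 (s * lam)) := Real.log_nonneg (le_max_left _ _)
  rcases le_total s (1 / 2) with h | h
  · have : Real.log (lam / 2) ≤ Real.log (max 1 ((1 - s) * lam)) :=
      Real.log_le_log (by positivity) (le_max_of_le_right (by nlinarith))
    linarith
  · have : Real.log (lam / 2) ≤ Real.log (max 1 (s * lam)) :=
      Real.log_le_log (by positivity) (le_max_of_le_right (by nlinarith))
    linarith

end TzitzeicaSurface

open TzitzeicaSurface in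
theorem mainTheorem9
    {M : Type*} [MetricSpace M] [CompactSpace M] [ConnectedSpace M]
    [MeasurableSpace M] [BorelSpace M]
    [ChartedSpace (EuclideanSpace ℝ (Fin 2)) M] [IsManifold (𝓡 2) ∞ M]
    [RiemannianBundle (fun x : M => TangentSpace (𝓡 2) x)]
    [IsContMDiffRiemannianBundle (𝓡 2) ∞ (EuclideanSpace ℝ (Fin 2))
      (fun x : M => TangentSpace (𝓡 2) x)]
    [IsRiemannianManifold (𝓡 2) M]
    (hvol : TzitzeicaSurface.riemannianVolume M Set.univ = 1)
    (h₁ h₂ : M → ℝ)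
    (hh₁ : ContMDiff (𝓡 2) 𝓘(ℝ, ℝ) ∞ h₁) (hh₂ : ContMDiff (𝓡 2) 𝓘(ℝ, ℝ) ∞ h₂)
    (hpos₁ : ∀ x, 0 < h₁ x) (hpos₂ : ∀ x, 0 < h₂ x)
    (γ₁ γ₂ : Circle → M) (hγ₁ : Continuous γ₁) (hγ₂ : Continuous γ₂)
    (hinj₁ : Function.Injective γ₁) (hinj₂ : Function.Injective γ₂)
    (hdisj : Disjoint (Set.range γ₁) (Set.range γ₂))
    (k l : ℕ) (ρ₁ ρ₂ : ℝ)
    (hρ₁ : ρ₁ ∈ Set.Ioo (8 * k * Real.pi) (8 * (k + 1) * Real.pi))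
    (hρ₂ : ρ₂ ∈ Set.Ioo (4 * l * Real.pi) (4 * (l + 1) * Real.pi)) :
    (∀ (lam : ℝ), 0 < lam →
      ∀ ζ : TzitzeicaSurface.Join (TzitzeicaSurface.formalBarycentres (Set.range γ₁) k)
        (TzitzeicaSurface.formalBarycentres (Set.range γ₂) l),
        TzitzeicaSurface.MemH1 (TzitzeicaSurface.testFunction lam ζ)) ∧
    (∀ L : ℝ, ∃ Λ : ℝ, 0 < Λ ∧ ∀ lam : ℝ, Λ ≤ lam →
      ∀ ζ : TzitzeicaSurface.Join (TzitzeicaSurface.formalBarycentres (Set.range γ₁) k)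
        (TzitzeicaSurface.formalBarycentres (Set.range γ₂) l),
        TzitzeicaSurface.energy h₁ h₂ ρ₁ ρ₂ (TzitzeicaSurface.testFunction lam ζ) ≤ -L) := by
  have : IsProbabilityMeasure (riemannianVolume M) := ⟨hvol⟩
  have : IsContinuousRiemannianBundle Plane (fun x : M => TangentSpace (𝓡 2) x) := by
    obtain ⟨g, hg, hg'⟩ := IsContMDiffRiemannianBundle.exists_contMDiff (IB := 𝓡 2) (n := ∞)
      (F := EuclideanSpace ℝ (Fin 2)) (E := fun x : M => TangentSpace (𝓡 2) x)
    exact ⟨g, hg.continuous, hg'⟩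
  refine ⟨fun lam hlam ζ => ?_, fun L => ?_⟩
  · obtain ⟨t, p, t', q, s, ht, hsum, -, ht', hsum', -, hs0, hs1, hζ⟩ :=
      exists_testFunction_eq lam ζ
    obtain ⟨K, hK⟩ := exists_lipschitzWith_bubble_sub (p := p) (q := q) ht hsum ht' hsum'
      (mul_nonneg (sub_nonneg.2 hs1) hlam.le) (mul_nonneg hs0 hlam.le)
    rw [hζ]
    exact memH1_of_lipschitzWith hK
  obtain ⟨δ, hδ, hsep⟩ := exists_pos_le_dist_of_disjoint hγ₁ hγ₂ hdisj
  obtain ⟨m₁, hm₁, hle₁⟩ := exists_pos_le_of_continuous hh₁.continuous hpos₁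
  obtain ⟨m₂, hm₂, hle₂⟩ := exists_pos_le_of_continuous hh₂.continuous hpos₂
  have hρ₁0 : 0 < ρ₁ := lt_of_le_of_lt (by positivity) hρ₁.1
  have hρ₂0 : 0 < ρ₂ := lt_of_le_of_lt (by positivity) hρ₂.1
  -- The strict bounds 16kπ < 2ρ₁ and 4lπ < ρ₂ survive a small η, so both logarithms get negative
  -- coefficients for one fixed η.
  have hlim : ∀ A B : ℝ, A < B →
      ∀ᶠ η in 𝓝[>] (0 : ℝ), (1 + η) ^ 4 * A - B + |ρ₁ - ρ₂| * η < 0 := by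
    intro A B hAB
    have hc : Continuous fun η : ℝ => (1 + η) ^ 4 * A - B + |ρ₁ - ρ₂| * η := by fun_prop
    have h0 := hc.tendsto 0
    simp only [add_zero, one_pow, one_mul, mul_zero] at h0
    exact nhdsWithin_le_nhds (h0.eventually (gt_mem_nhds (by linarith)))
  obtain ⟨η, hη, h1, h2⟩ := ((eventually_mem_nhdsWithin (a := (0 : ℝ)) (s := Ioi 0)).and
    ((hlim (16 * k * Real.pi) (2 * ρ₁) (by linarith [hρ₁.1])).and
      (hlim (4 * l * Real.pi) ρ₂ hρ₂.1))).exists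
  obtain ⟨C, hC⟩ := exists_energy_bubble_sub_le k l hδ hη hρ₁0.le hρ₂0.le hh₁.continuous
    hh₂.continuous (lt_min hm₁ hm₂) (fun x => (min_le_left m₁ m₂).trans (hle₁ x))
    (fun x => (min_le_right m₁ m₂).trans (hle₂ x))
  set e₁ := (1 + η) ^ 4 * (16 * k * Real.pi) - 2 * ρ₁ + |ρ₁ - ρ₂| * η
  set e₂ := (1 + η) ^ 4 * (4 * l * Real.pi) - ρ₂ + |ρ₁ - ρ₂| * η
  set c := min (-e₁) (-e₂) with hc
  have hc0 : 0 < c := lt_min (by linarith) (by linarith)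
  have hc1 : c ≤ -e₁ := min_le_left _ _
  have hc2 : c ≤ -e₂ := min_le_right _ _
  -- Chosen so that c log(λ/2) ≥ C + L for every λ beyond it, where -c bounds both coefficients from
  -- above.
  refine ⟨2 * Real.exp ((C + L) / c), by positivity, fun lam hlam ζ => ?_⟩
  have hlam0 : 0 < lam := lt_of_lt_of_le (by positivity) hlam
  obtain ⟨t, p, t', q, s, ht, hsum, hp, ht', hsum', hq, hs0, hs1, hζ⟩ :=
    exists_testFunction_eq lam ζ
  rw [hζ]
  refine (hC t p t' q _ _ ht hsum ht' hsum' (fun i j => hsep _ (hp i) _ (hq j))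
    (mul_nonneg (sub_nonneg.2 hs1) hlam0.le) (mul_nonneg hs0 hlam0.le)).trans ?_
  have h3 : (C + L) / c ≤ Real.log (lam / 2) := by
    rw [Real.le_log_iff_exp_le (by positivity)]
    linarith
  have h4 := h3.trans (log_half_le_add_log_max (s := s) hlam0)
  rw [div_le_iff₀ hc0] at h4
  have h5 : 0 ≤ Real.log (max 1 ((1 - s) * lam)) := Real.log_nonneg (le_max_left _ _)
  have h6 : 0 ≤ Real.log (max 1 (s * lam)) := Real.log_nonneg (le_max_left _ _)
  nlinarith [mul_le_mul_of_nonneg_right hc1 h5, mul_le_mul_of_nonneg_right hc2 h6]
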